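/- Let $D$ be a division algebra of finite degree $d$ over its center $C$ (so $[D:C]=d^2$), and let $\sigma$ be a ring automorphism of $D$ of finite order $n$ modulo inner automorphisms, with $\sigma^n(z)=uzu^{-1}$ for all $z\in D$, where $u\in D^\times$ and $\sigma(u)=u$. Let $R=D[t;\sigma]$ (with $ta=\sigma(a)t$ for $a\in D$) and $F=C\cap{\rm Fix}(\sigma)$. Let $f\in R$ be monic and irreducible of degree $m>1$, with no non-unit common right divisor with $t$, and not right-invariant (that is, $Rf$ is not a two-sided ideal). Let $h(t)=\hat h(u^{-1}t^n)$, with $\hat h\in F[x]$ monic, be the minimal central left multiple of $f$, i.e. the element of minimal degree among the nonzero elements of $F[u^{-1}t^n]\cap Rf$; put $E_{\hat h}=F[x]/(\hat h)$, and let $k$ be the number of irreducible factors in a factorization of $h$ in $R$. Let $S_f$ be the nonassociative ring of all $g\in R$ with $\deg g<m$, whose product of $g_1,g_2$ is the remainder of $g_1g_2$ under right division by $f$, and let $B={\rm Nuc}_r(S_f)=\{b\in S_f : (xy)b=x(yb)\ \text{for all}\ x,y\in S_f\}$. Then $V_f=R/Rf$ is a left $R$-module and a right $B$-module via $(a+Rf)b=ab+Rf$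 (for $\deg a<m$). Let $\rho$ be a ring automorphism of $D$ such that $F$ is finite-dimensional over $F'={\rm Fix}(\rho)\cap F$, let $\nu\in D$, let $l$ be an integer with $0<l<k$, and let $$A=\Big\{\sum_{i=0}^{lm-1}d_it^i+\nu\rho(d_0)t^{lm} : d_i\in D\Big\},\qquad S=S_{n,m,l}(\nu,\rho,f)=\{a+Rh : a\in A\}\subseteq R/Rh.$$ Suppose that $A$ contains no polynomial of degree $lm$ all of whose irreducible factors are similar to $f$ (where $p$ is similar to $f$ if $R/Rp\cong R/Rf$ as left $R$-modules). Then $B$ is a division algebra, finite-dimensional over $F'$, and $V_f$ has a right $B$-basis with $k$ elements. For every such basis, let $M_a\in M_k(B)$ be the matrix of the left multiplication $x\mapsto ax$ of $V_f$, and let $\mathcal C=\{M_a : a+Rh\in S\}\subseteq M_k(B)$. Then $\mathcal C$ is an $F'$-linear generalized MRD code with minimum distance $k-l+1$. This means that $\mathcal C$ is an $F'$-subspace of $M_k(B)$, that the minimum $d_{\mathcal C}$ of the column ranks (dimensions of the right $B$-modules generated by the columns) of the differences of two distinct elements of $\mathcal C$ equals $k-l+1$, and that the Singleton-like bound is attained: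 $\dim_{F'}\mathcal C=k(k-d_{\mathcal C}+1)[B:F']$. Moreover, if $\deg(h)=dmn$, then $k=dn$, there is an isomorphism of $F$-algebras $E_{\hat h}\cong B$ that sends the class of $x$ to the remainder of $u^{-1}t^n$ under right division by $f$, and under the identification $M_k(B)=M_{dn}(E_{\hat h})$ that it induces entrywise, $\mathcal C$ is an $F'$-linear (generalized) MRD code in $M_{dn}(E_{\hat h})$ with minimum distance $dn-l+1$. -/

import Mathlib

open scoped Polynomial

noncomputable section

namespace SkewMRD

open SkewPolynomial MulOpposite

/-! ### Degrees and right division in `D[t;σ]`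

`SkewPolynomial D` is the ring `D[t;σ]` with `t a = σ(a) t`; Mathlib encodes the endomorphism `σ`
by an action of `Multiplicative ℕ` on `D`, and calls it `SkewPolynomial.φ`. -/

section Division

variable {D : Type*} [DivisionRing D]

/-- The degree of a skew polynomial, with the value `0` at the zero polynomial. -/
def natDegree (p : SkewPolynomial D) : ℕ := p.support.sup id

theorem coeff_eq_zero_of_lt {p : SkewPolynomial D} {i : ℕ} (h : natDegree p < i) :
    coeff p i = 0 := by
  by_contra hne
  have h1 : i ≤ natDegree p := Finset.le_sup (f := id) (mem_support_iff.2 hne)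
  omega

theorem coeff_natDegree_ne_zero {p : SkewPolynomial D} (hp : p ≠ 0) :
    coeff p (natDegree p) ≠ 0 := by
  have hne : p.support.Nonempty :=
    Finset.nonempty_iff_ne_empty.2 (fun h => hp (support_eq_empty.1 h))
  obtain ⟨i, hi, hi'⟩ := Finset.exists_mem_eq_sup _ hne (id : ℕ → ℕ)
  have : natDegree p = i := hi'
  rw [this]
  exact mem_support_iff.1 hi

theorem coeff_smul' (c : D) (p : SkewPolynomial D) (i : ℕ) : coeff (c • p) i = c * coeff p i := rfl

/-- The space of representatives for division by `f`: if `f ≠ 0` has degree `m`, this is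
`R_m = {g | deg g < m}`, and it is everything for `f = 0`. -/
def reduced (f : SkewPolynomial D) : Submodule D (SkewPolynomial D) where
  carrier := {g | f ≠ 0 → ∀ i, natDegree f ≤ i → coeff g i = 0}
  add_mem' ha hb h0 i hi := by simp [ha h0 i hi, hb h0 i hi]
  zero_mem' _ _ _ := by simp
  smul_mem' c g hg h0 i hi := by rw [coeff_smul', hg h0 i hi, mul_zero]

variable [MulSemiringAction (Multiplicative ℕ) D]

theorem coeff_monomial_mul (N : ℕ) (c : D) (p : SkewPolynomial D) (i : ℕ) :
    coeff (monomial N c * p) (N + i) = c * φ^[N] (coeff p i) := by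
  rw [φ_iterate_apply]
  exact SkewMonoidAlgebra.coeff_single_mul_aux p (fun a => by
    change Multiplicative.ofAdd N * a = Multiplicative.ofAdd N * Multiplicative.ofAdd i ↔ _
    exact mul_left_cancel_iff)

theorem iterate_eq_zero {N : ℕ} {c : D} : φ^[N] c = 0 ↔ c = 0 := by
  rw [φ_iterate_apply]
  exact map_eq_zero (MulSemiringAction.toRingHom (Multiplicative ℕ) D (Multiplicative.ofAdd N))

theorem coeff_mul_eq_sum (q p : SkewPolynomial D) (i : ℕ) :
    coeff (q * p) i = ∑ j ∈ q.support, coeff (monomial j (coeff q j) * p) i := by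
  let ev : SkewPolynomial D →+ D :=
    { toFun := fun g => coeff g i, map_zero' := by simp, map_add' := by simp }
  have h1 : q * p = ∑ j ∈ q.support, monomial j (coeff q j) * p := by
    conv_lhs => rw [← sum_monomial q, sum_def, Finset.sum_mul]
  have h2 : ev (q * p) = ∑ j ∈ q.support, ev (monomial j (coeff q j) * p) := by
    conv_lhs => rw [h1]
    exact map_sum ev _ _
  exact h2

theorem coeff_mul_top {q p : SkewPolynomial D} {a b : ℕ} (ha : ∀ i, a < i → coeff q i = 0)
    (hb : ∀ i, b < i → coeff p i = 0) :
    coeff (q * p) (a + b) = coeff q a * φ^[a] (coeff p b) := by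
  have key : ∀ j, j ∈ q.support → j ≠ a → coeff (monomial j (coeff q j) * p) (a + b) = 0 := by
    intro j hj hja
    have hj' : j ≤ a := by
      by_contra hlt
      exact mem_support_iff.1 hj (ha j (by omega))
    have he : a + b = j + (a + b - j) := by omega
    rw [he, coeff_monomial_mul, hb _ (by omega), iterate_eq_zero.2 rfl, mul_zero]
  rw [coeff_mul_eq_sum, Finset.sum_eq_single a key, coeff_monomial_mul]
  intro h
  rw [notMem_support_iff.1 h]
  simp

theorem coeff_mul_above {q p : SkewPolynomial D} {a b : ℕ} (ha : ∀ i, a < i → coeff q i = 0)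
    (hb : ∀ i, b < i → coeff p i = 0) {i : ℕ} (hi : a + b < i) : coeff (q * p) i = 0 := by
  rw [coeff_mul_eq_sum]
  refine Finset.sum_eq_zero fun j hj => ?_
  have hj' : j ≤ a := by
    by_contra hlt
    exact mem_support_iff.1 hj (ha j (by omega))
  have he : i = j + (i - j) := by omega
  rw [he, coeff_monomial_mul, hb _ (by omega), iterate_eq_zero.2 rfl, mul_zero]

/-- Existence of the remainder of right division by `f`. -/
theorem exists_mem_reduced (f g : SkewPolynomial D) :
    ∃ r ∈ reduced f, g - r ∈ Ideal.span {f} := by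
  by_cases hf : f = 0
  · exact ⟨g, fun h => absurd hf h, by simp⟩
  have main : ∀ (N : ℕ) (g : SkewPolynomial D), (∀ i, N ≤ i → coeff g i = 0) →
      ∃ r ∈ reduced f, g - r ∈ Ideal.span {f} := by
    intro N
    induction N with
    | zero =>
      intro g hg
      have : g = 0 := by ext i; simpa using hg i (Nat.zero_le i)
      exact ⟨0, zero_mem _, by simp [this]⟩
    | succ N ih =>
      intro g hg
      by_cases hN : natDegree f ≤ N
      · obtain ⟨e, rfl⟩ : ∃ e, N = e + natDegree f := ⟨N - natDegree f, by omega⟩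
        let q : SkewPolynomial D :=
          monomial e (coeff g (e + natDegree f) * (φ^[e] (coeff f (natDegree f)))⁻¹)
        have hq : ∀ i, e < i → coeff q i = 0 := fun i hi => by
          simp only [q]; rw [coeff_monomial, if_neg (by omega)]
        have hfb : ∀ i, natDegree f < i → coeff f i = 0 := fun i hi => coeff_eq_zero_of_lt hi
        obtain ⟨r, hr, hgr⟩ := ih (g - q * f) (by
          intro i hi
          rw [coeff_sub]
          rcases Nat.lt_or_ge (e + natDegree f) i with h | h
          · rw [hg i (by omega), coeff_mul_above hq hfb h, sub_zero]
          · obtain rfl : i = e + natDegree f := by omega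
            rw [coeff_mul_top hq hfb]
            simp only [q]
            rw [coeff_monomial, if_pos rfl, inv_mul_cancel_right₀, sub_self]
            exact fun h0 => coeff_natDegree_ne_zero hf (iterate_eq_zero.1 h0))
        refine ⟨r, hr, ?_⟩
        have : g - r = (g - q * f - r) + q * f := by abel
        rw [this]
        exact add_mem hgr (Ideal.mul_mem_left _ _ (Ideal.mem_span_singleton_self f))
      · exact ⟨g, fun _ i hi => hg i (by omega), by simp⟩
  exact main (natDegree g + 1) g fun i hi => coeff_eq_zero_of_lt hi

/-- Uniqueness of the remainder of right division by `f`. -/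
theorem eq_of_mem_reduced {f r s : SkewPolynomial D} (hr : r ∈ reduced f) (hs : s ∈ reduced f)
    (h : r - s ∈ Ideal.span {f}) : r = s := by
  obtain ⟨q, hq⟩ := Ideal.mem_span_singleton'.1 h
  rw [← sub_eq_zero, ← hq]
  by_cases hf : f = 0
  · simp [hf]
  by_contra hne
  have hq0 : q ≠ 0 := fun h0 => hne (by simp [h0])
  have h1 := coeff_mul_top (q := q) (p := f) (fun i hi => coeff_eq_zero_of_lt hi)
    (fun i hi => coeff_eq_zero_of_lt hi)
  rw [hq, (sub_mem hr hs : r - s ∈ reduced f) hf _ (by omega)] at h1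
  exact mul_ne_zero (coeff_natDegree_ne_zero hq0)
    (fun h0 => coeff_natDegree_ne_zero hf (iterate_eq_zero.1 h0)) h1.symm

/-- The remainder `g mod_r f` of right division by `f`: `g = q f + r` with `deg r < deg f`
(and `r = g` if `f = 0`). -/
def modR (f g : SkewPolynomial D) : SkewPolynomial D := (exists_mem_reduced f g).choose

theorem modR_mem (f g : SkewPolynomial D) : modR f g ∈ reduced f :=
  (exists_mem_reduced f g).choose_spec.1

theorem sub_modR_mem (f g : SkewPolynomial D) : g - modR f g ∈ Ideal.span {f} :=
  (exists_mem_reduced f g).choose_spec.2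

theorem modR_eq {f g r : SkewPolynomial D} (hr : r ∈ reduced f)
    (h : g - r ∈ Ideal.span {f}) : modR f g = r := by
  refine eq_of_mem_reduced (modR_mem f g) hr ?_
  have : modR f g - r = (g - r) - (g - modR f g) := by abel
  rw [this]
  exact sub_mem h (sub_modR_mem f g)

theorem modR_congr {f g g' : SkewPolynomial D} (h : g - g' ∈ Ideal.span {f}) :
    modR f g = modR f g' := by
  refine modR_eq (modR_mem f g') ?_
  have : g - modR f g' = (g - g') + (g' - modR f g') := by abel
  rw [this]
  exact add_mem h (sub_modR_mem f g')

theorem modR_of_mem {f g : SkewPolynomial D} (h : g ∈ reduced f) : modR f g = g :=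
  modR_eq h (by simp)

theorem modR_add (f g g' : SkewPolynomial D) : modR f (g + g') = modR f g + modR f g' := by
  refine modR_eq (add_mem (modR_mem f g) (modR_mem f g')) ?_
  have : g + g' - (modR f g + modR f g') = (g - modR f g) + (g' - modR f g') := by abel
  rw [this]
  exact add_mem (sub_modR_mem f g) (sub_modR_mem f g')

theorem modR_smul (f : SkewPolynomial D) (c : D) (g : SkewPolynomial D) :
    modR f (c • g) = c • modR f g := by
  refine modR_eq (Submodule.smul_mem _ c (modR_mem f g)) ?_
  have : c • g - c • modR f g = C c * (g - modR f g) := by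
    ext i
    have h := coeff_monomial_mul 0 c (g - modR f g) i
    rw [zero_add] at h
    rw [← monomial_zero_left, h]
    simp [coeff_smul', mul_sub]
  rw [this]
  exact Ideal.mul_mem_left _ _ (sub_modR_mem f g)

end Division

/-! ### The fields `F = C ∩ Fix(σ)` and `F' = Fix(ρ) ∩ F` -/

section Fields

variable (D : Type*) [DivisionRing D] [MulSemiringAction (Multiplicative ℕ) D]

/-- `C ∩ Fix(σ)` as a subfield of `D`, where `C` is the center of `D`. -/
def fixedCenter : Subfield D where
  carrier := {c | c ∈ Subring.center D ∧ φ c = c}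
  mul_mem' ha hb := ⟨mul_mem ha.1 hb.1, by rw [map_mul, ha.2, hb.2]⟩
  one_mem' := ⟨one_mem _, map_one _⟩
  add_mem' ha hb := ⟨add_mem ha.1 hb.1, by rw [map_add, ha.2, hb.2]⟩
  zero_mem' := ⟨zero_mem _, map_zero _⟩
  neg_mem' ha := ⟨neg_mem ha.1, by rw [map_neg, ha.2]⟩
  inv_mem' c hc := by
    refine ⟨?_, by rw [map_inv₀, hc.2]⟩
    have := hc.1
    rw [Subring.mem_center_iff] at this ⊢
    exact fun g => (Commute.inv_right₀ (this g : Commute g c)).eq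

/-- The field `F = C ∩ Fix(σ)`. -/
def FieldF : Type _ := fixedCenter D

variable {D}

/-- `Fix(ρ) ∩ C ∩ Fix(σ)` as a subfield of `D`. -/
def fixedCenterFix (ρ : D ≃+* D) : Subfield D where
  carrier := {c | c ∈ fixedCenter D ∧ ρ c = c}
  mul_mem' ha hb := ⟨mul_mem ha.1 hb.1, by rw [map_mul, ha.2, hb.2]⟩
  one_mem' := ⟨one_mem _, map_one _⟩
  add_mem' ha hb := ⟨add_mem ha.1 hb.1, by rw [map_add, ha.2, hb.2]⟩
  zero_mem' := ⟨zero_mem _, map_zero _⟩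
  neg_mem' ha := ⟨neg_mem ha.1, by rw [map_neg, ha.2]⟩
  inv_mem' c hc := ⟨inv_mem hc.1, by rw [map_inv₀, hc.2]⟩

/-- The field `F' = Fix(ρ) ∩ F`. -/
def FieldF' (ρ : D ≃+* D) : Type _ := fixedCenterFix ρ

theorem fixedCenter_comm {c : D} (hc : c ∈ fixedCenter D) (a : D) : a * c = c * a :=
  Subring.mem_center_iff.1 hc.1 a

theorem fixedCenter_smul {c : D} (hc : c ∈ fixedCenter D) (k : Multiplicative ℕ) : k • c = c := by
  have h : ∀ j : ℕ, φ^[j] c = c := fun j => Function.iterate_fixed hc.2 j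
  have := φ_iterate_apply (Multiplicative.toAdd k) c
  rw [h] at this
  exact this.symm

instance : Field (FieldF D) :=
  { (inferInstance : DivisionRing (fixedCenter D)) with
    mul_comm := fun a b => Subtype.ext (fixedCenter_comm b.2 a.1) }

instance : Algebra (FieldF D) D where
  algebraMap := (fixedCenter D).subtype
  smul c a := c.1 * a
  commutes' c a := (fixedCenter_comm c.2 a).symm
  smul_def' _ _ := rfl

instance : SMulCommClass (Multiplicative ℕ) (FieldF D) D where
  smul_comm k c a := by
    change k • (c.1 * a) = c.1 * k • a
    rw [smul_mul', fixedCenter_smul c.2]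

variable (ρ : D ≃+* D)

instance : Field (FieldF' ρ) :=
  { (inferInstance : DivisionRing (fixedCenterFix ρ)) with
    mul_comm := fun a b => Subtype.ext (fixedCenter_comm b.2.1 a.1) }

instance : Algebra (FieldF' ρ) D where
  algebraMap := (fixedCenterFix ρ).subtype
  smul c a := c.1 * a
  commutes' c a := (fixedCenter_comm c.2.1 a).symm
  smul_def' _ _ := rfl

instance : SMulCommClass (Multiplicative ℕ) (FieldF' ρ) D where
  smul_comm k c a := by
    change k • (c.1 * a) = c.1 * k • a
    rw [smul_mul', fixedCenter_smul c.2.1]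

/-- The inclusion `F' ⊆ F`. -/
instance : Algebra (FieldF' ρ) (FieldF D) :=
  RingHom.toAlgebra
    { toFun := fun c => ⟨c.1, c.2.1⟩
      map_one' := rfl
      map_mul' := fun _ _ => rfl
      map_zero' := rfl
      map_add' := fun _ _ => rfl }

instance : IsScalarTower (FieldF' ρ) (FieldF D) D where
  smul_assoc a b c := mul_assoc a.1 b.1 c

end Fields

/-! ### The right nucleus of a nonassociative ring -/

section Nucleus

variable (S : Type*) [NonAssocRing S]

/-- The right nucleus `Nuc_r(S) = {b | (x y) b = x (y b) for all x, y}`. -/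
def rightNucleus : AddSubgroup S where
  carrier := {b | ∀ x y : S, x * y * b = x * (y * b)}
  add_mem' ha hb x y := by rw [mul_add, mul_add, mul_add, ha, hb]
  zero_mem' x y := by simp
  neg_mem' ha x y := by rw [mul_neg, mul_neg, mul_neg, ha]

variable {S}

instance : Ring (rightNucleus S) :=
  { (inferInstance : AddCommGroup (rightNucleus S)) with
    mul := fun a b => ⟨a * b, fun x y => by
      rw [← b.2, a.2, b.2, b.2]⟩
    one := ⟨1, fun x y => by simp⟩
    mul_assoc := fun a b c => Subtype.ext (c.2 a b)
    one_mul := fun a => Subtype.ext (one_mul (a : S))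
    mul_one := fun a => Subtype.ext (mul_one (a : S))
    left_distrib := fun a b c => Subtype.ext (mul_add (a : S) b c)
    right_distrib := fun a b c => Subtype.ext (add_mul (a : S) b c)
    zero_mul := fun a => Subtype.ext (zero_mul (a : S))
    mul_zero := fun a => Subtype.ext (mul_zero (a : S)) }

variable {k : Type*} [Field k] [Module k S] [IsScalarTower k S S] [SMulCommClass k S S]

instance : Module k (rightNucleus S) where
  smul c b := ⟨c • (b : S), fun x y => by
    rw [mul_smul_comm, mul_smul_comm, mul_smul_comm, b.2]⟩
  one_smul b := Subtype.ext (one_smul k (b : S))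
  mul_smul c c' b := Subtype.ext (mul_smul c c' (b : S))
  smul_zero c := Subtype.ext (smul_zero c)
  smul_add c b b' := Subtype.ext (smul_add c (b : S) b')
  add_smul c c' b := Subtype.ext (add_smul c c' (b : S))
  zero_smul b := Subtype.ext (zero_smul k (b : S))

instance : Algebra k (rightNucleus S) :=
  Algebra.ofModule
    (fun c a b => Subtype.ext (smul_mul_assoc c (a : S) (b : S)))
    (fun c a b => Subtype.ext (mul_smul_comm c (a : S) (b : S)))

end Nucleus

/-! ### Petit algebras -/

section Petit

variable {D : Type*} [DivisionRing D] [MulSemiringAction (Multiplicative ℕ) D]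

/-- The Petit algebra `S_f`: the set `R_m = {g | deg g < m}`, `m = deg f`, with the
multiplication `g ∘ h = g h mod_r f`. -/
def PetitAlgebra (f : SkewPolynomial D) : Type _ := reduced f

instance (f : SkewPolynomial D) : AddCommGroup (PetitAlgebra f) :=
  inferInstanceAs (AddCommGroup (reduced f))

instance (k : Type*) [Field k] [Algebra k D] (f : SkewPolynomial D) : Module k (PetitAlgebra f) :=
  inferInstanceAs (Module k (reduced f))

/-- The skew polynomial of degree less than `deg f` underlying an element of `S_f`. -/
def PetitAlgebra.val {f : SkewPolynomial D} (x : PetitAlgebra f) : SkewPolynomial D :=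
  Subtype.val (p := (· ∈ reduced f)) x

/-- The class of `g mod_r f` in `S_f`. -/
def PetitAlgebra.mk (f g : SkewPolynomial D) : PetitAlgebra f := ⟨modR f g, modR_mem f g⟩


namespace PetitAlgebra

variable {f : SkewPolynomial D}

theorem ext' {x y : PetitAlgebra f} (h : x.val = y.val) : x = y := Subtype.ext h

theorem val_mem (x : PetitAlgebra f) : x.val ∈ reduced f := x.2

theorem val_add (x y : PetitAlgebra f) : (x + y).val = x.val + y.val := rfl

theorem val_zero : (0 : PetitAlgebra f).val = 0 := rfl

theorem val_smul {k : Type*} [Field k] [Algebra k D] (c : k) (x : PetitAlgebra f) :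
    (c • x).val = c • x.val := rfl

theorem val_mk (g : SkewPolynomial D) : (mk f g).val = modR f g := rfl

theorem mk_add (g g' : SkewPolynomial D) : mk f (g + g') = mk f g + mk f g' :=
  ext' (modR_add f g g')

theorem mk_smul {k : Type*} [Field k] [Algebra k D] (c : k) (g : SkewPolynomial D) :
    mk f (c • g) = c • mk f g := by
  refine ext' ?_
  rw [val_smul, val_mk, val_mk, ← algebraMap_smul D c g, ← algebraMap_smul D c (modR f g),
    modR_smul]

theorem mk_zero : mk f 0 = 0 := ext' (modR_of_mem (zero_mem _))

theorem mk_val (x : PetitAlgebra f) : mk f x.val = x := ext' (modR_of_mem x.val_mem)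

theorem mk_congr {g g' : SkewPolynomial D} (h : g - g' ∈ Ideal.span {f}) : mk f g = mk f g' :=
  ext' (modR_congr h)

instance : Mul (PetitAlgebra f) := ⟨fun x y => mk f (x.val * y.val)⟩

instance : One (PetitAlgebra f) := ⟨mk f 1⟩

theorem mul_def' (x y : PetitAlgebra f) : x * y = mk f (x.val * y.val) := rfl

theorem one_def' : (1 : PetitAlgebra f) = mk f 1 := rfl

/-- Either `1` has degree less than `deg f`, or `f` is a nonzero constant and `S_f = 0`. -/
theorem one_cases (f : SkewPolynomial D) :
    (1 : PetitAlgebra f).val = 1 ∨ Subsingleton (PetitAlgebra f) := by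
  by_cases h : f ≠ 0 ∧ natDegree f = 0
  · right
    have h0 : ∀ x : PetitAlgebra f, x.val = 0 := fun x => by
      ext i
      simpa using x.val_mem h.1 i (by omega)
    exact ⟨fun x y => ext' (by rw [h0, h0])⟩
  · left
    refine modR_of_mem fun hf i hi => ?_
    rw [coeff_one, if_neg]
    intro h0
    exact h ⟨hf, by omega⟩

instance : NonAssocRing (PetitAlgebra f) :=
  { (inferInstance : AddCommGroup (PetitAlgebra f)) with
    one_mul := fun x => by
      rcases one_cases f with h | h
      · rw [mul_def', h, one_mul, mk_val]
      · exact Subsingleton.elim _ _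
    mul_one := fun x => by
      rcases one_cases f with h | h
      · rw [mul_def', h, mul_one, mk_val]
      · exact Subsingleton.elim _ _
    left_distrib := fun x y z => by
      rw [mul_def', val_add, mul_add, mk_add]; rfl
    right_distrib := fun x y z => by
      rw [mul_def', val_add, add_mul, mk_add]; rfl
    zero_mul := fun x => by rw [mul_def', val_zero, zero_mul, mk_zero]
    mul_zero := fun x => by rw [mul_def', val_zero, mul_zero, mk_zero] }

variable {k : Type*} [Field k] [Algebra k D] [SMulCommClass (Multiplicative ℕ) k D]

instance : IsScalarTower k (PetitAlgebra f) (PetitAlgebra f) where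
  smul_assoc c x y := by
    change (c • x) * y = c • (x * y)
    rw [mul_def', mul_def', ← mk_smul, val_smul, smul_mul_assoc]

instance : SMulCommClass k (PetitAlgebra f) (PetitAlgebra f) where
  smul_comm c x y := by
    change c • (x * y) = x * (c • y)
    rw [mul_def', mul_def', ← mk_smul, val_smul, mul_smul_comm]

end PetitAlgebra

/-- The algebra `B = Nuc_r(S_f)`. -/
abbrev NucB (f : SkewPolynomial D) : Type _ := rightNucleus (PetitAlgebra f)

/-- The left `R`-module `V_f = R / R f`. -/
abbrev V (f : SkewPolynomial D) : Type _ := SkewPolynomial D ⧸ Ideal.span {f}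

/-- The representative of degree less than `deg f` of an element of `V_f`. -/
def rep {f : SkewPolynomial D} (x : V f) : PetitAlgebra f :=
  Quotient.liftOn' x (PetitAlgebra.mk f) fun _ _ h =>
    PetitAlgebra.mk_congr ((Submodule.quotientRel_def _).1 h)

section RightModule

variable {f : SkewPolynomial D}

theorem rep_mk (g : SkewPolynomial D) :
    rep (Submodule.Quotient.mk g : V f) = PetitAlgebra.mk f g := rfl

theorem rep_add (x y : V f) : rep (x + y) = rep x + rep y := by
  obtain ⟨g, rfl⟩ := Submodule.Quotient.mk_surjective _ x
  obtain ⟨g', rfl⟩ := Submodule.Quotient.mk_surjective _ y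
  rw [← Submodule.Quotient.mk_add, rep_mk, rep_mk, rep_mk, PetitAlgebra.mk_add]

theorem rep_zero : rep (0 : V f) = 0 := PetitAlgebra.mk_zero

/-- The class `g + R f` of an element `g` of `S_f`. -/
def toV (x : PetitAlgebra f) : V f := Submodule.Quotient.mk x.val

theorem rep_toV (x : PetitAlgebra f) : rep (toV x) = x := by
  rw [toV, rep_mk, PetitAlgebra.mk_val]

theorem toV_rep (x : V f) : toV (rep x) = x := by
  obtain ⟨g, rfl⟩ := Submodule.Quotient.mk_surjective _ x
  rw [rep_mk]
  refine ((Submodule.Quotient.eq _).2 ?_).symm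
  exact sub_modR_mem f g

theorem toV_add (x y : PetitAlgebra f) : toV (x + y) = toV x + toV y := rfl

/-- The right scalar multiplication of `V_f` by `B`: `(a + R f) (z + R f) = a z + R f` for `z ∈ B`
and `deg a < deg f`. -/
def rightMul (x : V f) (b : NucB f) : V f := toV (rep x * (b : PetitAlgebra f))

/-- The right `B`-module structure of `V_f`. Right `B`-modules are modules over `Bᵐᵒᵖ`. -/
instance : Module (NucB f)ᵐᵒᵖ (V f) where
  smul b x := rightMul x (unop b)
  one_smul x := by
    change toV (rep x * 1) = x
    rw [mul_one, toV_rep]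
  mul_smul b c x := by
    change toV (rep x * ((unop c : NucB f).1 * (unop b : NucB f).1)) =
      toV (rep (toV (rep x * (unop c : NucB f).1)) * (unop b : NucB f).1)
    rw [rep_toV, (unop b).2]
  smul_zero b := by
    change toV (rep 0 * (unop b : NucB f).1) = 0
    rw [rep_zero, zero_mul]; rfl
  smul_add b x y := by
    change toV (rep (x + y) * (unop b : NucB f).1) = _
    rw [rep_add, add_mul, toV_add]; rfl
  add_smul b c x := by
    change toV (rep x * ((unop b : NucB f).1 + (unop c : NucB f).1)) = _
    rw [mul_add, toV_add]; rfl
  zero_smul x := by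
    change toV (rep x * 0) = 0
    rw [mul_zero]; rfl

theorem op_smul_def (b : NucB f) (x : V f) : op b • x = rightMul x b := rfl

end RightModule

end Petit

/-! ### Generalized rank metric codes -/

section Codes

/-- The column rank of a matrix over a division ring `B`: the rank of the right `B`-module
generated by its columns. -/
def colRank {ι B : Type*} [Ring B] (M : Matrix ι ι B) : ℕ :=
  Module.finrank Bᵐᵒᵖ (Submodule.span Bᵐᵒᵖ (Set.range fun j : ι => fun i : ι => M i j))

/-- `𝒞 ⊆ M_ι(B)` has minimum distance `δ`. -/
def HasMinDist {ι B : Type*} [Ring B] (𝒞 : Set (Matrix ι ι B)) (δ : ℕ) : Prop :=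
  IsLeast {r | ∃ M ∈ 𝒞, ∃ N ∈ 𝒞, M ≠ N ∧ r = colRank (M - N)} δ

/-- `𝒞 ⊆ M_ι(B)`, with `k = |ι|`, is an `L`-linear generalized MRD code over the division algebra
`B` with minimum distance `δ`: it is an `L`-subspace whose dimension attains the Singleton-like
bound `dim_L 𝒞 = k (k - δ + 1) [B : L]`, all dimensions being finite. -/
structure IsGenMRDCode (L : Type*) [Field L] {ι B : Type*} [Fintype ι] [Ring B] [Module L B]
    (𝒞 : Set (Matrix ι ι B)) (δ : ℕ) : Prop where
  nontrivial : Nontrivial B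
  isUnit_of_ne_zero : ∀ b : B, b ≠ 0 → IsUnit b
  finite : Module.Finite L B
  minDist : HasMinDist 𝒞 δ
  dist_le : δ ≤ Fintype.card ι
  linear : ∃ W : Submodule L (Matrix ι ι B), (W : Set (Matrix ι ι B)) = 𝒞 ∧
    Module.finrank L W = Fintype.card ι * (Fintype.card ι - δ + 1) * Module.finrank L B

end Codes

/-! ### The construction -/

section Construction

variable {D : Type*} [DivisionRing D] [MulSemiringAction (Multiplicative ℕ) D]

/-- `p` is similar to `q`: `R / R p ≅ R / R q` as left `R`-modules. -/
def Similar (p q : SkewPolynomial D) : Prop := Nonempty (V p ≃ₗ[SkewPolynomial D] V q)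

/-- All irreducible factors of `g` are similar to `f`. -/
def AllIrreducibleFactorsSimilar (g f : SkewPolynomial D) : Prop :=
  ∀ p, Irreducible p → (∃ a b, g = a * p * b) → Similar p f

/-- `(f, g)_r = 1`: every common right divisor of `f` and `g` is a unit. -/
def RightCoprime (f g : SkewPolynomial D) : Prop :=
  ∀ p, (∃ a, f = a * p) → (∃ b, g = b * p) → IsUnit p

/-- `f` is right-invariant: the left ideal `R f` is two-sided. -/
def RightInvariant (f : SkewPolynomial D) : Prop :=
  ∀ g, f * g ∈ Ideal.span {f}

/-- `h` is a product of `k` irreducible factors. -/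
def HasNumFactors (h : SkewPolynomial D) (k : ℕ) : Prop :=
  ∃ P : List (SkewPolynomial D), (∀ p ∈ P, Irreducible p) ∧ P.prod = h ∧ P.length = k

/-- The central element `ĝ(u⁻¹ tⁿ)` of `R`, for `ĝ ∈ F[x]`. -/
def centralEval (u : D) (n : ℕ) (g : (FieldF D)[X]) : SkewPolynomial D :=
  Polynomial.aeval (C u⁻¹ * X ^ n : SkewPolynomial D) g

/-- `h(t) = ĥ(u⁻¹ tⁿ)` is the minimal central left multiple of `f`: `ĥ ∈ F[x]` is monic, `h ∈ R f`,
and `h` has minimal degree among the nonzero elements of `F[u⁻¹ tⁿ] ∩ R f`. -/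
structure IsMinCentralLeftMultiple (u : D) (n : ℕ) (f : SkewPolynomial D)
    (hhat : (FieldF D)[X]) : Prop where
  monic : hhat.Monic
  mem : ∃ g, centralEval u n hhat = g * f
  minimal : ∀ q : (FieldF D)[X], q ≠ 0 → (∃ g, centralEval u n q = g * f) →
    natDegree (centralEval u n hhat) ≤ natDegree (centralEval u n q)

/-- The set `A` of all `d₀ + d₁ t + ⋯ + d_{N-1} t^{N-1} + ν ρ(d₀) t^N` with `dᵢ ∈ D`. -/
def setA (ν : D) (ρ : D ≃+* D) (N : ℕ) : Set (SkewPolynomial D) :=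
  {a | ∃ d : ℕ → D, a = (∑ i ∈ Finset.range N, C (d i) * X ^ i) + C (ν * ρ (d 0)) * X ^ N}

/-- The set `S = {a + R h | a ∈ A} ⊆ R / R h`, where `A` is formed with `N = l m`. -/
def setS (ν : D) (ρ : D ≃+* D) (N : ℕ) (h : SkewPolynomial D) :
    Set (SkewPolynomial D ⧸ Ideal.span {h}) :=
  Submodule.Quotient.mk '' setA ν ρ N

/-- The matrix `M_a` over `B` of the left multiplication `L_a : V_f → V_f`, `x ↦ a x`, with respect
to a right `B`-basis `v` of `V_f`: `a v_j = ∑ i, v_i (M_a)_{ij}`. -/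
def leftMulMatrix {f : SkewPolynomial D} {ι : Type*} (v : Module.Basis ι (NucB f)ᵐᵒᵖ (V f))
    (a : SkewPolynomial D) : Matrix ι ι (NucB f) :=
  fun i j => unop (v.repr (a • v j) i)

/-- The code `𝒞(S) = {M_a | a + R h ∈ S}` in `M_ι(B)`. -/
def code {f : SkewPolynomial D} {ι : Type*} (v : Module.Basis ι (NucB f)ᵐᵒᵖ (V f))
    (h : SkewPolynomial D) (S : Set (SkewPolynomial D ⧸ Ideal.span {h})) :
    Set (Matrix ι ι (NucB f)) :=
  {M | ∃ a : SkewPolynomial D, (Submodule.Quotient.mk a : SkewPolynomial D ⧸ Ideal.span {h}) ∈ S ∧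
    M = leftMulMatrix v a}

end Construction

end SkewMRD

end

/-!
Since `f` is irreducible, `V_f` is a simple left `R`-module, and right multiplication identifies `B`
with the opposite of its endomorphism ring; so `B` is a division algebra, and by density `R` maps
onto `V_f^r` along any `r` right `B`-independent vectors. The annihilator of `V_f` is a two-sided
ideal whose generator is, up to a unit, central, hence equal to `h`. A `B`-basis of `V_f` therefore
gives `R/Rh ≅ V_f^k`, and `a ↦ M_a` is injective below degree `deg h`.

The ranks are controlled by the density argument once more. If `a ≠ 0` has degree at most `lm` and
kills `l` independent vectors, then their common annihilator `Rg` satisfies `R/Rg ≅ V_f^l`, so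
`deg g = lm` and `Ra = Rg`: then `deg a = lm` and all irreducible factors of `a` are similar to `f`,
which is excluded for `a ∈ A`. So every nonzero `M_a` with `a ∈ A` has rank greater than `k - l`,
and `dim A = lm [D : F'] = k l [B : F']` is the largest dimension that the Singleton-like bound
allows.

If `deg h = dmn`, comparing degrees and dimensions gives `k = dn` and `[B : F] ≤ deg ĥ`, so that the
embedding of `E_ĥ` into `B` that sends `x` to the class of `u⁻¹ tⁿ` is onto.
-/

noncomputable section

namespace SkewMRD

open SkewPolynomial MulOpposite

section Degree

variable {D : Type*} [DivisionRing D]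

theorem natDegree_le {p : SkewPolynomial D} {N : ℕ} (h : ∀ i, N < i → coeff p i = 0) :
    natDegree p ≤ N :=
  Finset.sup_le fun i hi => not_lt.1 fun hlt => mem_support_iff.1 hi (h i hlt)

theorem le_natDegree {p : SkewPolynomial D} {i : ℕ} (h : coeff p i ≠ 0) : i ≤ natDegree p :=
  not_lt.1 fun hlt => h (coeff_eq_zero_of_lt hlt)

theorem natDegree_monomial {N : ℕ} {c : D} (hc : c ≠ 0) : natDegree (monomial N c) = N := by
  simp [natDegree, support_monomial N hc]

theorem natDegree_X : natDegree (X : SkewPolynomial D) = 1 :=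
  natDegree_monomial one_ne_zero

theorem natDegree_C (c : D) : natDegree (C c) = 0 :=
  Nat.le_zero.1 (natDegree_le fun _ hi => coeff_C_ne_zero hi.ne')

theorem eq_C_of_natDegree_eq_zero {p : SkewPolynomial D} (h : natDegree p = 0) :
    p = C (coeff p 0) := by
  ext i
  rcases Nat.eq_zero_or_pos i with rfl | hi
  · rw [coeff_C_zero]
  · rw [coeff_eq_zero_of_lt (h ▸ hi), coeff_C_ne_zero hi.ne']

theorem coeff_sum {ι : Type*} (s : Finset ι) (p : ι → SkewPolynomial D) (i : ℕ) :
    coeff (∑ j ∈ s, p j) i = ∑ j ∈ s, coeff (p j) i :=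
  map_sum (AddMonoidHom.mk' (fun g : SkewPolynomial D => coeff g i) fun _ _ => coeff_add _ _ _) p s

theorem coeff_sum_monomial {m : ℕ} (d : Fin m → D) (j : ℕ) :
    coeff (∑ i : Fin m, monomial i (d i)) j = if h : j < m then d ⟨j, h⟩ else 0 := by
  simp_rw [coeff_sum, coeff_monomial]
  split_ifs with h
  · rw [Finset.sum_eq_single ⟨j, h⟩ (fun i _ hi => if_neg fun hij => hi (Fin.ext hij)) (by simp),
      if_pos rfl]
  · exact Finset.sum_eq_zero fun i _ => if_neg (by omega)

variable [MulSemiringAction (Multiplicative ℕ) D]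

theorem coeff_mul_natDegree (p q : SkewPolynomial D) :
    coeff (p * q) (natDegree p + natDegree q) =
      coeff p (natDegree p) * φ^[natDegree p] (coeff q (natDegree q)) :=
  coeff_mul_top (fun _ => coeff_eq_zero_of_lt) (fun _ => coeff_eq_zero_of_lt)

theorem coeff_mul_natDegree_ne_zero {p q : SkewPolynomial D} (hp : p ≠ 0) (hq : q ≠ 0) :
    coeff (p * q) (natDegree p + natDegree q) ≠ 0 := by
  rw [coeff_mul_natDegree]
  exact mul_ne_zero (coeff_natDegree_ne_zero hp)
    (mt iterate_eq_zero.1 (coeff_natDegree_ne_zero hq))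

instance : NoZeroDivisors (SkewPolynomial D) where
  eq_zero_or_eq_zero_of_mul_eq_zero {p q} h := by
    by_contra! hne
    exact coeff_mul_natDegree_ne_zero hne.1 hne.2 (by rw [h, coeff_zero])

instance : IsDomain (SkewPolynomial D) := NoZeroDivisors.to_isDomain _

theorem natDegree_mul {p q : SkewPolynomial D} (hp : p ≠ 0) (hq : q ≠ 0) :
    natDegree (p * q) = natDegree p + natDegree q :=
  le_antisymm
    (natDegree_le fun _ => coeff_mul_above (fun _ => coeff_eq_zero_of_lt)
      fun _ => coeff_eq_zero_of_lt)
    (le_natDegree (coeff_mul_natDegree_ne_zero hp hq))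

theorem isUnit_C {c : D} (hc : c ≠ 0) : IsUnit (C c : SkewPolynomial D) :=
  (IsUnit.mk0 c hc).map (CRingHom : D →+* SkewPolynomial D)

theorem isUnit_of_natDegree_eq_zero {p : SkewPolynomial D} (hp : p ≠ 0) (h : natDegree p = 0) :
    IsUnit p := by
  rw [eq_C_of_natDegree_eq_zero h] at hp ⊢
  exact isUnit_C (mt C_eq_zero.2 hp)

theorem coeff_C_mul (c : D) (p : SkewPolynomial D) (i : ℕ) : coeff (C c * p) i = c * coeff p i := by
  have h := coeff_monomial_mul 0 c p i
  rwa [zero_add, monomial_zero_left] at h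

end Degree

section LeftIdeals

variable {D : Type*} [DivisionRing D]

theorem natDegree_lt_of_mem_reduced {f r : SkewPolynomial D} (hf : f ≠ 0) (hr : r ∈ reduced f)
    (hr0 : r ≠ 0) : natDegree r < natDegree f :=
  not_le.1 fun h => coeff_natDegree_ne_zero hr0 (hr hf _ h)

variable [MulSemiringAction (Multiplicative ℕ) D]

theorem mul_mem_span (q g : SkewPolynomial D) : q * g ∈ Ideal.span {g} :=
  Ideal.mul_mem_left _ _ (Ideal.mem_span_singleton_self g)

theorem natDegree_le_of_mem_span {g p : SkewPolynomial D} (h : p ∈ Ideal.span {g}) (hp : p ≠ 0) :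
    natDegree g ≤ natDegree p := by
  obtain ⟨q, rfl⟩ := Ideal.mem_span_singleton'.1 h
  rw [natDegree_mul (left_ne_zero_of_mul hp) (right_ne_zero_of_mul hp)]
  exact Nat.le_add_left _ _

theorem span_eq_span_of_mem_of_natDegree_le {g p : SkewPolynomial D} (h : p ∈ Ideal.span {g})
    (hp : p ≠ 0) (hdeg : natDegree p ≤ natDegree g) : Ideal.span {p} = Ideal.span {g} := by
  obtain ⟨q, rfl⟩ := Ideal.mem_span_singleton'.1 h
  have hq := left_ne_zero_of_mul hp
  rw [natDegree_mul hq (right_ne_zero_of_mul hp)] at hdeg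
  exact Ideal.span_singleton_mul_left_unit (isUnit_of_natDegree_eq_zero hq (by omega)) g

/-- Left ideals only: a right ideal of `D[t;σ]` need not be principal unless `σ` is surjective. -/
instance : IsPrincipalIdealRing (SkewPolynomial D) where
  principal I := by
    rcases eq_or_ne I ⊥ with rfl | hI
    · exact bot_isPrincipal
    obtain ⟨p, ⟨hpI, hp⟩, hmin⟩ := (measure (natDegree (D := D))).wf.has_min
      {p | p ∈ I ∧ p ≠ 0} (Submodule.exists_mem_ne_zero_of_ne_bot hI)
    refine ⟨p, le_antisymm (fun q hq => ?_) ((Ideal.span_singleton_le_iff_mem I).2 hpI)⟩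
    have hrI : modR p q ∈ I := by
      have := I.sub_mem hq ((Ideal.span_singleton_le_iff_mem I).2 hpI (sub_modR_mem p q))
      rwa [sub_sub_cancel] at this
    have hr : modR p q = 0 := by
      by_contra hr
      exact hmin _ ⟨hrI, hr⟩ (natDegree_lt_of_mem_reduced hp (modR_mem p q) hr)
    simpa only [hr, sub_zero] using sub_modR_mem p q

theorem isUnit_of_span_eq_top {p : SkewPolynomial D} (h : Ideal.span {p} = ⊤) : IsUnit p := by
  obtain ⟨q, hq⟩ := Ideal.mem_span_singleton'.1 (h ▸ Submodule.mem_top : (1 : SkewPolynomial D) ∈ _)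
  exact IsUnit.of_mul_eq_one q (mul_eq_one_symm hq)

theorem isSimpleModule_V {f : SkewPolynomial D} (hf : Irreducible f) :
    IsSimpleModule (SkewPolynomial D) (V f) := by
  refine isSimpleModule_iff_isCoatom.2 ⟨fun h => hf.not_isUnit (isUnit_of_span_eq_top h), ?_⟩
  intro I hI
  obtain ⟨g, rfl⟩ := (IsPrincipalIdealRing.principal I).principal
  obtain ⟨q, hq⟩ := Ideal.mem_span_singleton'.1 (hI.le (Ideal.mem_span_singleton_self f))
  rcases hf.isUnit_or_isUnit hq.symm with hunit | hunit
  · exact absurd (Ideal.span_singleton_mul_left_unit hunit g) (hq ▸ hI.ne)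
  · exact Ideal.eq_top_of_isUnit_mem _ (Ideal.mem_span_singleton_self g) hunit

end LeftIdeals

section Dimension

variable {D : Type*} [DivisionRing D] [MulSemiringAction (Multiplicative ℕ) D]

/-- The coordinates `(d₀, …, d_{m-1})` of `d₀ + ⋯ + d_{m-1} t^{m-1}`, where `m = deg f`. -/
def reducedEquiv {f : SkewPolynomial D} (hf : f ≠ 0) :
    reduced f ≃ₗ[D] (Fin (natDegree f) → D) where
  toFun g i := coeff g.1 i
  map_add' g g' := by ext i; exact coeff_add _ _ _
  map_smul' c g := rfl
  invFun d := ⟨∑ i : Fin (natDegree f), monomial i (d i),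
    fun _ j hj => (coeff_sum_monomial d j).trans (dif_neg (not_lt.2 hj))⟩
  left_inv g := by
    refine Subtype.ext (SkewPolynomial.ext fun j => ?_)
    rw [coeff_sum_monomial]
    split_ifs with h
    · rfl
    · exact (g.2 hf j (not_lt.1 h)).symm
  right_inv d := funext fun j => (coeff_sum_monomial d j).trans (dif_pos j.2)

/-- Division with remainder as an isomorphism `R_m ≃ R / R f`. -/
def reducedEquivV (f : SkewPolynomial D) : reduced f ≃ₗ[D] V f :=
  LinearEquiv.ofBijective (M := reduced f) (M₂ := V f)
    { toFun := fun g => (Submodule.Quotient.mk g.1 : V f)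
      map_add' := fun _ _ => rfl
      map_smul' := fun _ _ => rfl }
    ⟨fun x y h => Subtype.ext (eq_of_mem_reduced x.2 y.2 ((Submodule.Quotient.eq _).1 h)),
      fun x => ⟨(rep x : PetitAlgebra f), toV_rep x⟩⟩

theorem finite_V {f : SkewPolynomial D} (hf : f ≠ 0) : Module.Finite D (V f) :=
  Module.Finite.equiv ((reducedEquiv hf).symm.trans (reducedEquivV f))

theorem finrank_V {f : SkewPolynomial D} (hf : f ≠ 0) :
    Module.finrank D (V f) = natDegree f := by
  rw [← ((reducedEquiv hf).symm.trans (reducedEquivV f)).finrank_eq, Module.finrank_fin_fun]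

theorem natDegree_eq_of_equiv_pi {f g : SkewPolynomial D} (hf : f ≠ 0) (hg : g ≠ 0)
    {ι : Type*} [Fintype ι] (e : V g ≃ₗ[SkewPolynomial D] (ι → V f)) :
    natDegree g = Fintype.card ι * natDegree f := by
  have := finite_V hf
  rw [← finrank_V hg, (e.restrictScalars D).finrank_eq, Module.finrank_pi_fintype]
  simp only [finrank_V hf, Finset.sum_const, Finset.card_univ, smul_eq_mul]

end Dimension

section RightNucleus

variable {D : Type*} [DivisionRing D] [MulSemiringAction (Multiplicative ℕ) D]
variable {f : SkewPolynomial D}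

theorem PetitAlgebra.mk_eq_mk_iff {g g' : SkewPolynomial D} :
    PetitAlgebra.mk f g = PetitAlgebra.mk f g' ↔ g - g' ∈ Ideal.span {f} := by
  refine ⟨fun h => ?_, PetitAlgebra.mk_congr⟩
  have hrem : modR f g = modR f g' := congrArg PetitAlgebra.val h
  have hdiff := sub_mem (sub_modR_mem f g) (sub_modR_mem f g')
  rwa [hrem, sub_sub_sub_cancel_right] at hdiff

theorem mul_mem_span_of_mem {b : SkewPolynomial D} (hb : f * b ∈ Ideal.span {f})
    {g : SkewPolynomial D} (hg : g ∈ Ideal.span {f}) : g * b ∈ Ideal.span {f} := by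
  obtain ⟨q, rfl⟩ := Ideal.mem_span_singleton'.1 hg
  rw [mul_assoc]
  exact Ideal.mul_mem_left _ _ hb

theorem modR_X_pow_natDegree (hf : f ≠ 0) :
    modR f (X ^ natDegree f) = X ^ natDegree f - C (coeff f (natDegree f))⁻¹ * f := by
  refine modR_eq (fun _ i hi => ?_) ?_
  · rw [coeff_sub, X_pow_eq_monomial, coeff_monomial, coeff_C_mul]
    rcases hi.eq_or_lt with rfl | hi
    · rw [if_pos rfl, inv_mul_cancel₀ (coeff_natDegree_ne_zero hf), sub_self]
    · rw [if_neg hi.ne, coeff_eq_zero_of_lt hi, mul_zero, sub_zero]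
  · rw [sub_sub_cancel]
    exact mul_mem_span _ _

theorem mul_mem_span_of_mem_rightNucleus (hm : 1 < natDegree f) {b : PetitAlgebra f}
    (hb : b ∈ rightNucleus (PetitAlgebra f)) : f * b.val ∈ Ideal.span {f} := by
  have hf : f ≠ 0 := by rintro rfl; simp [natDegree] at hm
  have hX : X ∈ reduced f := fun _ i hi => by rw [coeff_X, if_neg (by omega)]
  have hXm : (X ^ (natDegree f - 1) : SkewPolynomial D) ∈ reduced f := fun _ i hi => by
    rw [X_pow_eq_monomial, coeff_monomial, if_neg (by omega)]
  -- The associator of `t`, `t ^ (m - 1)` and `b` is the class of `-c⁻¹ f b`, `c` leading in `f`.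
  have hassoc : PetitAlgebra.mk f (modR f (X * X ^ (natDegree f - 1)) * b.val) =
      PetitAlgebra.mk f (X * modR f (X ^ (natDegree f - 1) * b.val)) := hb ⟨X, hX⟩ ⟨_, hXm⟩
  have hmem := sub_mem (PetitAlgebra.mk_eq_mk_iff.1 hassoc)
    (Ideal.mul_mem_left _ X (sub_modR_mem f (X ^ (natDegree f - 1) * b.val)))
  rw [mul_sub, sub_sub_sub_cancel_right, ← mul_assoc, ← pow_succ', Nat.sub_add_cancel hm.le,
    modR_X_pow_natDegree hf, sub_mul, sub_sub_cancel_left, neg_mem_iff, mul_assoc] at hmem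
  have hc := coeff_natDegree_ne_zero hf
  simpa only [← mul_assoc, ← C_mul, mul_inv_cancel₀ hc, C_1, one_mul] using
    Ideal.mul_mem_left _ (C (coeff f (natDegree f))) hmem

theorem mem_rightNucleus_of_mul_mem_span {b : PetitAlgebra f} (hb : f * b.val ∈ Ideal.span {f}) :
    b ∈ rightNucleus (PetitAlgebra f) := fun x y => by
  have hr : x * (y * b) = PetitAlgebra.mk f (x.val * (y.val * b.val)) := by
    refine (PetitAlgebra.mk_eq_mk_iff.2 ?_).symm
    rw [← mul_sub]
    exact Ideal.mul_mem_left _ _ (sub_modR_mem f _)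
  change PetitAlgebra.mk f (modR f (x.val * y.val) * b.val) = x * (y * b)
  rw [hr, PetitAlgebra.mk_eq_mk_iff, ← mul_assoc, ← sub_mul, ← neg_sub, neg_mul]
  exact neg_mem (mul_mem_span_of_mem hb (sub_modR_mem f _))

theorem mk_mem_rightNucleus {z : SkewPolynomial D} (hz : f * z ∈ Ideal.span {f}) :
    PetitAlgebra.mk f z ∈ rightNucleus (PetitAlgebra f) := by
  refine mem_rightNucleus_of_mul_mem_span ?_
  have hsub := sub_mem hz (Ideal.mul_mem_left _ f (sub_modR_mem f z))
  rwa [mul_sub, sub_sub_cancel] at hsub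

variable [Fact (1 < natDegree f)]

theorem op_smul_mk (b : (NucB f)ᵐᵒᵖ) (g : SkewPolynomial D) :
    b • (Submodule.Quotient.mk g : V f) = Submodule.Quotient.mk (g * (unop b).1.val) := by
  refine (Submodule.Quotient.eq _).2 ?_
  change modR f (modR f g * (unop b).1.val) - g * (unop b).1.val ∈ Ideal.span {f}
  have hb := mul_mem_span_of_mem_rightNucleus Fact.out (unop b).2
  have hmul := mul_mem_span_of_mem hb (sub_modR_mem f g)
  rw [sub_mul] at hmul
  have hsum := neg_mem (add_mem hmul (sub_modR_mem f (modR f g * (unop b).1.val)))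
  rwa [sub_add_sub_cancel, neg_sub] at hsum

instance : SMulCommClass (NucB f)ᵐᵒᵖ (SkewPolynomial D) (V f) where
  smul_comm b r x := by
    obtain ⟨g, rfl⟩ := Submodule.Quotient.mk_surjective _ x
    rw [op_smul_mk, ← Submodule.Quotient.mk_smul, ← Submodule.Quotient.mk_smul, op_smul_mk,
      smul_eq_mul, smul_eq_mul, mul_assoc]

instance : SMulCommClass (SkewPolynomial D) (NucB f)ᵐᵒᵖ (V f) := SMulCommClass.symm _ _ _

instance {K : Type*} [Field K] [Algebra K D] [SMulCommClass (Multiplicative ℕ) K D] :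
    IsScalarTower K (NucB f)ᵐᵒᵖ (V f) where
  smul_assoc c b x := by
    obtain ⟨g, rfl⟩ := Submodule.Quotient.mk_surjective _ x
    rw [op_smul_mk, op_smul_mk, ← Submodule.Quotient.mk_smul]
    exact congrArg Submodule.Quotient.mk (mul_smul_comm c g (unop b).1.val)

theorem toModuleEnd_op_injective :
    Function.Injective (Module.toModuleEnd (SkewPolynomial D) (S := (NucB f)ᵐᵒᵖ) (V f)) := by
  refine (injective_iff_map_eq_zero _).2 fun b hb => unop_injective (Subtype.ext ?_)
  have hb1 : b • (Submodule.Quotient.mk 1 : V f) = 0 := LinearMap.congr_fun hb _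
  rw [op_smul_mk, one_mul, Submodule.Quotient.mk_eq_zero] at hb1
  rw [← PetitAlgebra.mk_val (unop b).1, PetitAlgebra.mk_eq_mk_iff.2 (by rwa [sub_zero]),
    PetitAlgebra.mk_zero]
  rfl

theorem toModuleEnd_op_surjective :
    Function.Surjective (Module.toModuleEnd (SkewPolynomial D) (S := (NucB f)ᵐᵒᵖ) (V f)) := by
  intro T
  obtain ⟨w, hw⟩ := Submodule.Quotient.mk_surjective _ (T (Submodule.Quotient.mk 1))
  have hT (g : SkewPolynomial D) : T (Submodule.Quotient.mk g) = Submodule.Quotient.mk (g * w) := by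
    rw [← mul_one g, ← smul_eq_mul, Submodule.Quotient.mk_smul, map_smul, ← hw,
      ← Submodule.Quotient.mk_smul, smul_eq_mul, smul_eq_mul, mul_one]
  have hfw : f * w ∈ Ideal.span {f} := by
    rw [← Submodule.Quotient.mk_eq_zero, ← hT,
      (Submodule.Quotient.mk_eq_zero _).2 (Ideal.mem_span_singleton_self f), map_zero]
  refine ⟨op ⟨PetitAlgebra.mk f w, mk_mem_rightNucleus hfw⟩, LinearMap.ext fun x => ?_⟩
  obtain ⟨g, rfl⟩ := Submodule.Quotient.mk_surjective _ x
  rw [hT, Module.toModuleEnd_apply, DistribSMul.toLinearMap_apply, op_smul_mk, eq_comm,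
    Submodule.Quotient.eq, ← mul_sub]
  exact Ideal.mul_mem_left _ _ (sub_modR_mem f w)

variable (f) in
/-- `Nuc_r(S_f)` is the opposite of the endomorphism ring of `V_f = R / R f`, acting on `V_f` by
right multiplications. -/
def nucBEquivEnd : (NucB f)ᵐᵒᵖ ≃+* Module.End (SkewPolynomial D) (V f) :=
  RingEquiv.ofBijective (Module.toModuleEnd (SkewPolynomial D) (V f))
    ⟨toModuleEnd_op_injective, toModuleEnd_op_surjective⟩

variable [Fact (Irreducible f)]

instance : IsSimpleModule (SkewPolynomial D) (V f) := isSimpleModule_V Fact.out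

instance : Nontrivial (NucB f) :=
  have := IsSimpleModule.nontrivial (SkewPolynomial D) (V f)
  have := (nucBEquivEnd f).symm.injective.nontrivial
  opEquiv.nontrivial

instance : DivisionRing (NucB f) :=
  DivisionRing.ofIsUnitOrEqZero fun b => by
    classical
    refine or_iff_not_imp_right.2 fun hb => ?_
    have hunit : IsUnit (nucBEquivEnd f (op b)) := IsUnit.mk0 _ (by simpa using hb)
    exact isUnit_op.1 ((isUnit_map_iff (nucBEquivEnd f) _).1 hunit)

end RightNucleus

section Density

variable {R E M : Type*} [Ring R] [AddCommGroup M] [Module R M]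

/-- Evaluation of ring elements at a family of vectors, `r ↦ (r wᵢ)ᵢ`. -/
def evalMap {ι : Type*} (w : ι → M) : R →ₗ[R] (ι → M) :=
  LinearMap.pi fun i => LinearMap.toSpanSingleton R M (w i)

theorem mem_ker_evalMap {ι : Type*} {w : ι → M} {r : R} :
    r ∈ LinearMap.ker (evalMap w) ↔ ∀ i, r • w i = 0 := funext_iff

theorem ker_evalMap_of_span_eq_top [Semiring E] [Module E M] [SMulCommClass R E M] {ι : Type*}
    {w : ι → M} (hw : Submodule.span E (Set.range w) = ⊤) :
    LinearMap.ker (evalMap w) = Module.annihilator R M := by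
  ext r
  rw [mem_ker_evalMap, Module.mem_annihilator]
  refine ⟨fun h x => ?_, fun h i => h _⟩
  exact LinearMap.congr_fun (f := Module.toModuleEnd E M r) (g := 0)
    (LinearMap.ext_on_range hw h) x

variable [DivisionRing E] [Module E M] [SMulCommClass E R M]

theorem exists_linearMap_of_linearIndependent {ι : Type*} {w : ι → M} (hw : LinearIndependent E w)
    (x : ι → M) : ∃ T : M →ₗ[E] M, ∀ i, T (w i) = x i := by
  obtain ⟨T, hT⟩ := LinearMap.exists_extend ((Module.Basis.span hw).constr ℕ x)
  refine ⟨T, fun i => ?_⟩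
  rw [← (Module.Basis.span hw).constr_basis ℕ x i, ← hT, LinearMap.comp_apply,
    Submodule.subtype_apply, Module.Basis.span_apply]

theorem evalMap_surjective [IsSemisimpleModule R M]
    (hE : Function.Surjective (Module.toModuleEnd R (S := E) M)) {ι : Type*} [Finite ι] {w : ι → M}
    (hw : LinearIndependent E w) : Function.Surjective (evalMap (R := R) w) := by
  classical
  have := Fintype.ofFinite ι
  intro x
  obtain ⟨T, hT⟩ := exists_linearMap_of_linearIndependent hw x
  let T' : Module.End (Module.End R M) M :=
    { toFun := T
      map_add' := map_add T
      map_smul' := fun φ y => by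
        obtain ⟨b, rfl⟩ := hE φ
        exact map_smul T b y }
  obtain ⟨r, hr⟩ := jacobson_density T' (Finset.univ.image w)
  refine ⟨r, funext fun i => ?_⟩
  rw [← hT i]
  exact (hr _ (Finset.mem_image_of_mem _ (Finset.mem_univ i))).symm

theorem nonempty_quotient_equiv_pi [IsSemisimpleModule R M]
    (hE : Function.Surjective (Module.toModuleEnd R (S := E) M)) {ι : Type*} [Finite ι] {w : ι → M}
    (hw : LinearIndependent E w) {I : Submodule R R} (hI : LinearMap.ker (evalMap w) = I) :
    Nonempty ((R ⧸ I) ≃ₗ[R] (ι → M)) := by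
  subst hI
  have e := (evalMap (R := R) w).quotKerEquivOfSurjective (evalMap_surjective hE hw)
  exact ⟨e⟩

end Density

section SimpleModules

variable {R S T M ι : Type*} [Ring R] [AddCommGroup S] [Module R S] [AddCommGroup T] [Module R T]
  [AddCommGroup M] [Module R M] [IsSimpleModule R S] [IsSimpleModule R T]

theorem nonempty_equiv_of_injective_pi {j : S →ₗ[R] (ι → T)} (hj : Function.Injective j) :
    Nonempty (S ≃ₗ[R] T) := by
  have := IsSimpleModule.nontrivial R S
  obtain ⟨x, hx⟩ := exists_ne (0 : S)
  obtain ⟨i, hi⟩ := Function.ne_iff.1 ((map_ne_zero_iff j hj).2 hx)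
  have hne : LinearMap.proj i ∘ₗ j ≠ 0 := fun h => hi (LinearMap.congr_fun h x)
  exact ⟨LinearEquiv.ofBijective _ (LinearMap.bijective_of_ne_zero hne)⟩

theorem nonempty_equiv_of_surjective_pi_of_injective [Finite ι] {q : (ι → T) →ₗ[R] M}
    (hq : Function.Surjective q) {j : S →ₗ[R] M} (hj : Function.Injective j) :
    Nonempty (S ≃ₗ[R] T) := by
  obtain ⟨j', rfl⟩ := IsSemisimpleModule.lifting_property q hq j
  exact nonempty_equiv_of_injective_pi (Function.Injective.of_comp (f := q) hj)

end SimpleModules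

section Length

variable {D : Type*} [DivisionRing D] [MulSemiringAction (Multiplicative ℕ) D]

/-- The homomorphism `R / R p → R / R p q` induced by right multiplication with `q`. -/
def mulRightV (p q : SkewPolynomial D) : V p →ₗ[SkewPolynomial D] V (p * q) :=
  Submodule.mapQ _ _ (LinearMap.toSpanSingleton (SkewPolynomial D) (SkewPolynomial D) q) <| by
    rw [Submodule.span_le, Set.singleton_subset_iff]
    exact Ideal.mem_span_singleton_self (p * q)

theorem mulRightV_mk (p q r : SkewPolynomial D) :
    mulRightV p q (Submodule.Quotient.mk r) = Submodule.Quotient.mk (r * q) := rfl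

theorem mulRightV_injective (p : SkewPolynomial D) {q : SkewPolynomial D} (hq : q ≠ 0) :
    Function.Injective (mulRightV p q) := by
  refine (injective_iff_map_eq_zero _).2 fun x hx => ?_
  obtain ⟨r, rfl⟩ := Submodule.Quotient.mk_surjective _ x
  rw [mulRightV_mk, Submodule.Quotient.mk_eq_zero] at hx
  obtain ⟨s, hs⟩ := Ideal.mem_span_singleton'.1 hx
  rw [← mul_assoc] at hs
  rw [Submodule.Quotient.mk_eq_zero, ← mul_right_cancel₀ hq hs]
  exact mul_mem_span _ _

theorem length_V_mul (p : SkewPolynomial D) {q : SkewPolynomial D} (hq : q ≠ 0) :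
    Module.length (SkewPolynomial D) (V (p * q)) =
      Module.length (SkewPolynomial D) (V p) + Module.length (SkewPolynomial D) (V q) := by
  have hle : Ideal.span {p * q} ≤ Ideal.span {q} :=
    (Ideal.span_singleton_le_iff_mem _).2 (mul_mem_span p q)
  refine Module.length_eq_add_of_exact (mulRightV p q) (Submodule.factor hle)
    (mulRightV_injective p hq) (Submodule.factor_surjective hle) fun x => ?_
  obtain ⟨r, rfl⟩ := Submodule.Quotient.mk_surjective _ x
  change (Submodule.Quotient.mk r : V q) = 0 ↔ _
  rw [Submodule.Quotient.mk_eq_zero]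
  constructor
  · intro h
    obtain ⟨s, rfl⟩ := Ideal.mem_span_singleton'.1 h
    exact ⟨Submodule.Quotient.mk s, rfl⟩
  · rintro ⟨y, hy⟩
    obtain ⟨s, rfl⟩ := Submodule.Quotient.mk_surjective _ y
    rw [mulRightV_mk, Submodule.Quotient.eq] at hy
    exact (Submodule.sub_mem_iff_right _ (mul_mem_span s q)).1 (hle hy)

theorem length_V_of_hasNumFactors {h : SkewPolynomial D} {k : ℕ} (hk : HasNumFactors h k) :
    Module.length (SkewPolynomial D) (V h) = k := by
  obtain ⟨P, hP, rfl, rfl⟩ := hk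
  induction P with
  | nil =>
    have : Subsingleton (V (List.prod ([] : List (SkewPolynomial D)))) :=
      Submodule.Quotient.subsingleton_iff.2 Ideal.span_singleton_one
    exact Module.length_eq_zero
  | cons p P ih =>
    have := isSimpleModule_V (hP p List.mem_cons_self)
    have hP' (q) (hq : q ∈ P) : Irreducible q := hP q (List.mem_cons_of_mem p hq)
    have hne : P.prod ≠ 0 := List.prod_ne_zero fun h0 => (hP' 0 h0).ne_zero rfl
    rw [List.prod_cons, length_V_mul p hne, ih hP', Module.length_eq_one, List.length_cons,
      Nat.cast_succ, add_comm]

theorem allIrreducibleFactorsSimilar_of_equiv {f g : SkewPolynomial D} (hf : Irreducible f)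
    (hg : g ≠ 0) {ι : Type*} [Finite ι] (e : V g ≃ₗ[SkewPolynomial D] (ι → V f)) :
    AllIrreducibleFactorsSimilar g f := by
  rintro p hp ⟨x, y, rfl⟩
  have := isSimpleModule_V hf
  have := isSimpleModule_V hp
  have hle : Ideal.span {x * p * y} ≤ Ideal.span {p * y} := by
    rw [Ideal.span_singleton_le_iff_mem, mul_assoc]
    exact mul_mem_span _ _
  exact nonempty_equiv_of_surjective_pi_of_injective
    (q := Submodule.factor hle ∘ₗ e.symm.toLinearMap)
    ((Submodule.factor_surjective hle).comp e.symm.surjective)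
    (mulRightV_injective p (right_ne_zero_of_mul hg))

end Length

section Coefficients

variable {D : Type*} [DivisionRing D] [MulSemiringAction (Multiplicative ℕ) D]

theorem coeff_mul_C (p : SkewPolynomial D) (a : D) (i : ℕ) :
    coeff (p * C a) i = coeff p i * φ^[i] a := by
  rw [coeff_mul_eq_sum, Finset.sum_eq_single i]
  · rw [monomial_mul_C, coeff_monomial, if_pos rfl]
  · intro j _ hj
    rw [monomial_mul_C, coeff_monomial, if_neg hj]
  · intro h
    rw [notMem_support_iff.1 h, monomial_zero_right, zero_mul, coeff_zero]

theorem coeff_mul_X (p : SkewPolynomial D) (i : ℕ) : coeff (p * X) (i + 1) = coeff p i := by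
  rw [coeff_mul_eq_sum, Finset.sum_eq_single i]
  · rw [monomial_mul_X, coeff_monomial, if_pos rfl]
  · intro j _ hj
    rw [monomial_mul_X, coeff_monomial, if_neg (by omega)]
  · intro h
    rw [notMem_support_iff.1 h, monomial_zero_right, zero_mul, coeff_zero]

theorem coeff_mul_X_zero (p : SkewPolynomial D) : coeff (p * X) 0 = 0 := by
  rw [coeff_mul_eq_sum]
  exact Finset.sum_eq_zero fun j _ => by rw [monomial_mul_X, coeff_monomial_succ]

theorem coeff_X_mul (p : SkewPolynomial D) (i : ℕ) : coeff (X * p) (i + 1) = φ (coeff p i) := by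
  have h := coeff_monomial_mul 1 1 p i
  rwa [one_mul, add_comm] at h

theorem exists_eq_mul_X {p : SkewPolynomial D} (h : coeff p 0 = 0) : ∃ q, p = q * X := by
  refine ⟨∑ j : Fin (natDegree p), monomial j (coeff p (j + 1)), ?_⟩
  ext (_ | i)
  · rw [h, coeff_mul_X_zero]
  · rw [coeff_mul_X, coeff_sum_monomial (fun j : Fin _ => coeff p (j + 1))]
    split_ifs with hi
    · rfl
    · exact coeff_eq_zero_of_lt (by omega)

theorem coeff_mul_zero (p q : SkewPolynomial D) :
    coeff (p * q) 0 = coeff p 0 * coeff q 0 := by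
  obtain ⟨r, hr⟩ := exists_eq_mul_X (p := p - C (coeff p 0)) (by
    rw [coeff_sub, coeff_C_zero, sub_self])
  calc coeff (p * q) 0 = coeff (r * (X * q) + C (coeff p 0) * q) 0 := by
        rw [← mul_assoc, ← hr, ← add_mul, sub_add_cancel]
    _ = coeff p 0 * coeff q 0 := by
        rw [coeff_add, X_mul, ← mul_assoc, coeff_mul_X_zero, zero_add, coeff_C_mul]

theorem exists_mul_X_eq_X_mul (hφ : Function.Surjective (φ : D → D)) (p : SkewPolynomial D) :
    ∃ q, p * X = X * q := by
  choose ψ hψ using hφ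
  refine ⟨∑ j ∈ p.support, monomial j (ψ (coeff p j)), ?_⟩
  conv_lhs => rw [← sum_monomial p, sum_def]
  rw [Finset.sum_mul, Finset.mul_sum]
  exact Finset.sum_congr rfl fun j _ => by rw [monomial_mul_X, X_mul_monomial, hψ]

end Coefficients

section Center

variable {D : Type*} [DivisionRing D] [MulSemiringAction (Multiplicative ℕ) D]
variable {g : SkewPolynomial D}

theorem mem_center_of_commute (hC : ∀ a, Commute (C a) g) (hX : Commute X g) :
    g ∈ Subring.center (SkewPolynomial D) := by
  refine Subring.mem_center_iff.2 fun p => ?_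
  have hsum : Commute (∑ j ∈ p.support, monomial j (coeff p j)) g :=
    Commute.sum_left _ _ _ fun j _ => by
      rw [← C_mul_X_pow_eq_monomial]
      exact (hC _).mul_left (hX.pow_left j)
  rwa [← sum_def, sum_monomial] at hsum

theorem natDegree_eq_of_mul_eq_mul {p q : SkewPolynomial D} (hg : g ≠ 0) (hp : p ≠ 0)
    (h : q * g = g * p) : natDegree q = natDegree p := by
  have hq : q ≠ 0 := left_ne_zero_of_mul (h ▸ mul_ne_zero hg hp)
  have hdeg := congrArg natDegree h
  rwa [natDegree_mul hq hg, natDegree_mul hg hp, add_comm, Nat.add_left_cancel_iff] at hdeg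

theorem commute_C_of_rightInvariant (hg : RightInvariant g) (hg1 : coeff g 0 = 1) (a : D) :
    Commute (C a) g := by
  rcases eq_or_ne a 0 with rfl | ha
  · rw [C_0]
    exact Commute.zero_left g
  have hg0 : g ≠ 0 := by rintro rfl; exact zero_ne_one hg1
  obtain ⟨q, hq⟩ := Ideal.mem_span_singleton'.1 (hg (C a))
  have hqC := eq_C_of_natDegree_eq_zero
    ((natDegree_eq_of_mul_eq_mul hg0 (isUnit_C ha).ne_zero hq).trans (natDegree_C a))
  have hconst := congrArg (fun p => coeff p 0) hq
  simp only [coeff_mul_zero, hg1, mul_one, one_mul, coeff_C_zero] at hconst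
  rwa [hqC, hconst] at hq

theorem commute_X_of_rightInvariant (hg : RightInvariant g) (hg1 : coeff g 0 = 1) :
    Commute X g := by
  have hg0 : g ≠ 0 := by rintro rfl; exact zero_ne_one hg1
  obtain ⟨q, hq⟩ := Ideal.mem_span_singleton'.1 (hg X)
  have hconst := congrArg (fun p => coeff p 0) hq
  simp only [coeff_mul_zero, hg1, mul_one, coeff_X_zero, mul_zero] at hconst
  obtain ⟨p, rfl⟩ := exists_eq_mul_X hconst
  have hp0 : p ≠ 0 := left_ne_zero_of_mul (left_ne_zero_of_mul (hq ▸ mul_ne_zero hg0 X_ne_zero))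
  have hdeg := natDegree_eq_of_mul_eq_mul hg0 X_ne_zero hq
  rw [natDegree_mul hp0 X_ne_zero, Nat.add_eq_right] at hdeg
  have hlin := congrArg (fun p => coeff p 1) hq
  rw [eq_C_of_natDegree_eq_zero hdeg] at hlin hq
  simp only [mul_assoc, coeff_C_mul, coeff_X_mul, coeff_mul_X, hg1, map_one, mul_one] at hlin
  rwa [hlin, C_1, one_mul] at hq

theorem mem_center_of_rightInvariant (hg : RightInvariant g) (hg1 : coeff g 0 = 1) :
    g ∈ Subring.center (SkewPolynomial D) :=
  mem_center_of_commute (commute_C_of_rightInvariant hg hg1) (commute_X_of_rightInvariant hg hg1)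

theorem coeff_mul_iterate_of_mem_center (hg : g ∈ Subring.center (SkewPolynomial D)) (i : ℕ)
    (a : D) : coeff g i * φ^[i] a = a * coeff g i := by
  rw [← coeff_mul_C, ← coeff_C_mul, Subring.mem_center_iff.1 hg]

theorem map_coeff_of_mem_center (hg : g ∈ Subring.center (SkewPolynomial D)) (i : ℕ) :
    φ (coeff g i) = coeff g i := by
  rw [← coeff_X_mul, Subring.mem_center_iff.1 hg, coeff_mul_X]

end Center

section InnerPower

variable {D : Type*} [DivisionRing D] [MulSemiringAction (Multiplicative ℕ) D]

variable (D) in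
/-- The power `σ ^ j` of the automorphism `σ = φ` is inner. -/
def IsInnerIterate (j : ℕ) : Prop := ∃ w : D, w ≠ 0 ∧ ∀ z : D, φ^[j] z = w * z * w⁻¹

/-- The power `σ ^ n`, `n > 0`, of the automorphism `σ = φ` is conjugation by `u`, and `σ u = u`:
the condition that makes `u⁻¹ tⁿ` central in `D[t;σ]`. -/
structure IsInnerPower (u : D) (n : ℕ) : Prop where
  pos : 0 < n
  ne_zero : u ≠ 0
  iterate_apply : ∀ z : D, φ^[n] z = u * z * u⁻¹
  map_eq : φ u = u

namespace IsInnerPower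

variable {u : D} {n : ℕ}

theorem iterate_mul_apply (hun : IsInnerPower u n) (j : ℕ) (z : D) :
    φ^[n * j] z = u ^ j * z * (u ^ j)⁻¹ := by
  induction j with
  | zero => simp
  | succ j ih =>
    rw [Nat.mul_succ, add_comm, Function.iterate_add_apply, ih, hun.iterate_apply, pow_succ' u j,
      mul_inv_rev]
    simp only [mul_assoc]

theorem surjective (hun : IsInnerPower u n) : Function.Surjective (φ : D → D) := by
  refine Function.Surjective.of_comp (g := φ^[n - 1]) fun z => ⟨u⁻¹ * z * u, ?_⟩
  rw [← Function.iterate_succ', Nat.succ_eq_add_one, Nat.sub_add_cancel hun.pos,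
    hun.iterate_apply, ← mul_assoc, mul_inv_cancel_right₀ hun.ne_zero,
    mul_inv_cancel_left₀ hun.ne_zero]

theorem dvd_of_isInnerIterate (hun : IsInnerPower u n)
    (hmin : ∀ j, 0 < j → j < n → ¬ IsInnerIterate D j) {i : ℕ} (hi : IsInnerIterate D i) :
    n ∣ i := by
  by_contra hdvd
  obtain ⟨w, hw, hconj⟩ := hi
  have hU : u ^ (i / n) ≠ 0 := pow_ne_zero _ hun.ne_zero
  refine hmin (i % n) (Nat.pos_of_ne_zero fun h => hdvd (Nat.dvd_of_mod_eq_zero h))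
    (Nat.mod_lt _ hun.pos) ⟨(u ^ (i / n))⁻¹ * w, mul_ne_zero (inv_ne_zero hU) hw, fun z => ?_⟩
  have hz := hconj z
  rw [← Nat.div_add_mod i n, Function.iterate_add_apply, hun.iterate_mul_apply,
    mul_inv_eq_iff_eq_mul₀ hU, ← eq_inv_mul_iff_mul_eq₀ hU] at hz
  rw [hz, mul_inv_rev, inv_inv]
  simp only [mul_assoc]

theorem C_inv_mul_X_pow_pow (hun : IsInnerPower u n) (j : ℕ) :
    (C u⁻¹ * X ^ n : SkewPolynomial D) ^ j = monomial (n * j) (u ^ j)⁻¹ := by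
  induction j with
  | zero => simp [← C_1]
  | succ j ih =>
    rw [pow_succ, ih, C_mul_X_pow_eq_monomial, monomial_mul_monomial, hun.iterate_mul_apply,
      mul_assoc (u ^ j), inv_mul_cancel_left₀ (pow_ne_zero j hun.ne_zero), pow_succ u j,
      mul_inv_rev, Nat.mul_succ]

theorem C_inv_mul_X_pow_mem_center (hun : IsInnerPower u n) :
    (C u⁻¹ * X ^ n : SkewPolynomial D) ∈ Subring.center (SkewPolynomial D) := by
  have hφ : φ u⁻¹ = u⁻¹ := by rw [map_inv₀, hun.map_eq]
  rw [C_mul_X_pow_eq_monomial]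
  refine mem_center_of_commute (fun a => ?_) ?_
  · rw [Commute, SemiconjBy, C_mul_monomial, monomial_mul_C, hun.iterate_apply, mul_assoc u,
      inv_mul_cancel_left₀ hun.ne_zero]
  · rw [Commute, SemiconjBy, X_mul_monomial, monomial_mul_X, hφ]

theorem centralEval_mem_center (hun : IsInnerPower u n) (q : (FieldF D)[X]) :
    centralEval u n q ∈ Subring.center (SkewPolynomial D) := by
  have hcomm (p : SkewPolynomial D) : Commute p (C u⁻¹ * X ^ n) :=
    Subring.mem_center_iff.1 hun.C_inv_mul_X_pow_mem_center p
  refine Subring.mem_center_iff.2 fun p => ?_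
  rw [centralEval, Polynomial.aeval_eq_sum_range]
  exact Commute.sum_right _ _ _ fun j _ => ((hcomm p).pow_right j).smul_right _

theorem centralEval_monomial (hun : IsInnerPower u n) (j : ℕ) (c : FieldF D) :
    centralEval u n (Polynomial.monomial j c) = monomial (n * j) (c.1 * (u ^ j)⁻¹) := by
  rw [centralEval, Polynomial.aeval_monomial, hun.C_inv_mul_X_pow_pow, ← Algebra.smul_def,
    smul_monomial]
  rfl

theorem coeff_centralEval_mul (hun : IsInnerPower u n) (q : (FieldF D)[X]) (j : ℕ) :
    coeff (centralEval u n q) (n * j) = (q.coeff j).1 * (u ^ j)⁻¹ := by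
  induction q using Polynomial.induction_on' with
  | add p q hp hq =>
    have hadd : centralEval u n (p + q) = centralEval u n p + centralEval u n q := map_add _ _ _
    rw [hadd, coeff_add, hp, hq, ← add_mul, Polynomial.coeff_add]
    rfl
  | monomial i c =>
    rw [hun.centralEval_monomial, coeff_monomial, Polynomial.coeff_monomial]
    rcases eq_or_ne i j with rfl | hij
    · rw [if_pos rfl, if_pos rfl]
    · rw [if_neg hij, if_neg fun h => hij (Nat.eq_of_mul_eq_mul_left hun.pos h)]
      exact (zero_mul _).symm

theorem coeff_centralEval_of_not_dvd (hun : IsInnerPower u n) (q : (FieldF D)[X]) {i : ℕ}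
    (hi : ¬ n ∣ i) : coeff (centralEval u n q) i = 0 := by
  induction q using Polynomial.induction_on' with
  | add p q hp hq =>
    have hadd : centralEval u n (p + q) = centralEval u n p + centralEval u n q := map_add _ _ _
    rw [hadd, coeff_add, hp, hq, add_zero]
  | monomial j c =>
    rw [hun.centralEval_monomial, coeff_monomial, if_neg fun h => hi ⟨j, h.symm⟩]

theorem natDegree_centralEval (hun : IsInnerPower u n) (q : (FieldF D)[X]) :
    natDegree (centralEval u n q) = n * q.natDegree := by
  rcases eq_or_ne q 0 with rfl | hq
  · rw [centralEval, map_zero, Polynomial.natDegree_zero]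
    exact Nat.le_zero.1 (natDegree_le fun _ _ => rfl)
  refine le_antisymm (natDegree_le fun i hi => ?_) (le_natDegree ?_)
  · by_cases hd : n ∣ i
    · obtain ⟨j, rfl⟩ := hd
      rw [hun.coeff_centralEval_mul,
        Polynomial.coeff_eq_zero_of_natDegree_lt (Nat.lt_of_mul_lt_mul_left hi)]
      exact zero_mul _
    · exact hun.coeff_centralEval_of_not_dvd q hd
  · rw [hun.coeff_centralEval_mul]
    exact mul_ne_zero (fun h => Polynomial.leadingCoeff_ne_zero.2 hq (Subtype.ext h))
      (inv_ne_zero (pow_ne_zero _ hun.ne_zero))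

theorem centralEval_ne_zero (hun : IsInnerPower u n) {q : (FieldF D)[X]} (hq : q ≠ 0) :
    centralEval u n q ≠ 0 := fun h => by
  have hcoeff := hun.coeff_centralEval_mul q q.natDegree
  rw [h, coeff_zero, eq_comm, mul_eq_zero] at hcoeff
  exact Polynomial.leadingCoeff_ne_zero.2 hq (Subtype.ext
    (hcoeff.resolve_right (inv_ne_zero (pow_ne_zero _ hun.ne_zero))))

variable {g : SkewPolynomial D}

theorem dvd_of_mem_center_of_coeff_ne_zero (hun : IsInnerPower u n)
    (hmin : ∀ j, 0 < j → j < n → ¬ IsInnerIterate D j)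
    (hg : g ∈ Subring.center (SkewPolynomial D)) {i : ℕ} (hi : coeff g i ≠ 0) : n ∣ i := by
  refine hun.dvd_of_isInnerIterate hmin ⟨(coeff g i)⁻¹, inv_ne_zero hi, fun a => ?_⟩
  rw [inv_inv, mul_assoc, ← coeff_mul_iterate_of_mem_center hg, inv_mul_cancel_left₀ hi]

theorem coeff_mul_pow_mem_fixedCenter (hun : IsInnerPower u n)
    (hg : g ∈ Subring.center (SkewPolynomial D)) (j : ℕ) :
    coeff g (n * j) * u ^ j ∈ fixedCenter D := by
  refine ⟨Subring.mem_center_iff.2 fun a => ?_, ?_⟩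
  · rw [← mul_assoc, ← coeff_mul_iterate_of_mem_center hg, hun.iterate_mul_apply, ← mul_assoc,
      inv_mul_cancel_right₀ (pow_ne_zero j hun.ne_zero), mul_assoc]
  · rw [map_mul, map_pow, hun.map_eq, map_coeff_of_mem_center hg]

theorem exists_centralEval_eq_of_mem_center (hun : IsInnerPower u n)
    (hmin : ∀ j, 0 < j → j < n → ¬ IsInnerIterate D j)
    (hg : g ∈ Subring.center (SkewPolynomial D)) : ∃ q : (FieldF D)[X], centralEval u n q = g := by
  let c (j : ℕ) : FieldF D := ⟨_, hun.coeff_mul_pow_mem_fixedCenter hg j⟩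
  have hc (j : ℕ) (hj : natDegree g < j) : c j = 0 := Subtype.ext <| by
    change coeff g (n * j) * u ^ j = 0
    rw [coeff_eq_zero_of_lt (hj.trans_le (Nat.le_mul_of_pos_left j hun.pos)), zero_mul]
  refine ⟨∑ j ∈ Finset.range (natDegree g + 1), Polynomial.monomial j (c j), ?_⟩
  ext i
  by_cases hi : n ∣ i
  · obtain ⟨j, rfl⟩ := hi
    have hcoeff : (∑ j ∈ Finset.range (natDegree g + 1), Polynomial.monomial j (c j)).coeff j =
        c j := by
      simp only [Polynomial.finsetSum_coeff, Polynomial.coeff_monomial, Finset.sum_ite_eq',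
        Finset.mem_range]
      exact ite_eq_left_iff.2 fun hj => (hc j (by omega)).symm
    rw [hun.coeff_centralEval_mul, hcoeff]
    exact mul_inv_cancel_right₀ (pow_ne_zero j hun.ne_zero) _
  · rw [hun.coeff_centralEval_of_not_dvd _ hi, eq_comm]
    exact not_not.1 fun hne => hi (hun.dvd_of_mem_center_of_coeff_ne_zero hmin hg hne)

end IsInnerPower

end InnerPower

section Annihilator

variable {D : Type*} [DivisionRing D] [MulSemiringAction (Multiplicative ℕ) D]

theorem X_smul_surjective (hφ : Function.Surjective (φ : D → D)) {M : Type*} [AddCommGroup M]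
    [Module (SkewPolynomial D) M] [IsSimpleModule (SkewPolynomial D) M]
    (hX : X ∉ Module.annihilator (SkewPolynomial D) M) :
    Function.Surjective fun x : M => (X : SkewPolynomial D) • x := by
  let XM : Submodule (SkewPolynomial D) M :=
    { carrier := Set.range fun x : M => (X : SkewPolynomial D) • x
      zero_mem' := ⟨0, smul_zero _⟩
      add_mem' := by
        rintro _ _ ⟨x, rfl⟩ ⟨y, rfl⟩
        exact ⟨x + y, smul_add _ _ _⟩
      smul_mem' := by
        rintro r _ ⟨x, rfl⟩
        obtain ⟨q, hq⟩ := exists_mul_X_eq_X_mul hφ r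
        exact ⟨q • x, by simp only [smul_smul, hq]⟩ }
  have hXM : XM ≠ ⊥ := fun h => hX <| Module.mem_annihilator.2 fun x =>
    (Submodule.eq_bot_iff XM).1 h _ ⟨x, rfl⟩
  exact fun y => (Submodule.eq_top_iff'.1 ((eq_bot_or_eq_top XM).resolve_left hXM)) y

variable {f g : SkewPolynomial D}

theorem mem_span_of_mem_annihilator (hg : g ∈ Module.annihilator (SkewPolynomial D) (V f)) :
    g ∈ Ideal.span {f} := by
  have := Module.mem_annihilator.1 hg (Submodule.Quotient.mk 1)
  rwa [← Submodule.Quotient.mk_smul, smul_eq_mul, mul_one, Submodule.Quotient.mk_eq_zero] at this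

theorem mem_annihilator_of_mem_center (hg : g ∈ Subring.center (SkewPolynomial D))
    (hgf : g ∈ Ideal.span {f}) : g ∈ Module.annihilator (SkewPolynomial D) (V f) := by
  refine Module.mem_annihilator.2 fun x => ?_
  obtain ⟨r, rfl⟩ := Submodule.Quotient.mk_surjective _ x
  rw [← Submodule.Quotient.mk_smul, smul_eq_mul, ← Subring.mem_center_iff.1 hg,
    Submodule.Quotient.mk_eq_zero]
  exact Ideal.mul_mem_left _ _ hgf

theorem rightInvariant_of_annihilator_eq_span {M : Type*} [AddCommGroup M]
    [Module (SkewPolynomial D) M]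
    (hg : Module.annihilator (SkewPolynomial D) M = Ideal.span {g}) : RightInvariant g := fun p =>
  hg ▸ Ideal.mul_mem_right p _ (hg ▸ Ideal.mem_span_singleton_self g)

/-- If `g = p t`, then `p` kills `t M = M`, so `g` would not have minimal degree. -/
theorem coeff_zero_ne_zero_of_annihilator_eq_span (hφ : Function.Surjective (φ : D → D))
    {M : Type*} [AddCommGroup M] [Module (SkewPolynomial D) M]
    [IsSimpleModule (SkewPolynomial D) M] (hX : X ∉ Module.annihilator (SkewPolynomial D) M)
    (hg0 : g ≠ 0) (hg : Module.annihilator (SkewPolynomial D) M = Ideal.span {g}) :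
    coeff g 0 ≠ 0 := by
  intro h0
  obtain ⟨p, rfl⟩ := exists_eq_mul_X h0
  have hp0 : p ≠ 0 := left_ne_zero_of_mul hg0
  have hp : p ∈ Module.annihilator (SkewPolynomial D) M := by
    refine Module.mem_annihilator.2 fun x => ?_
    obtain ⟨y, rfl⟩ := X_smul_surjective hφ hX x
    rw [smul_smul]
    exact Module.mem_annihilator.1 (hg ▸ Ideal.mem_span_singleton_self _) y
  have hdeg := natDegree_le_of_mem_span (hg ▸ hp) hp0
  rw [natDegree_mul hp0 X_ne_zero, natDegree_X] at hdeg
  omega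

theorem exists_mem_center_annihilator_eq_span (hφ : Function.Surjective (φ : D → D))
    {M : Type*} [AddCommGroup M] [Module (SkewPolynomial D) M]
    [IsSimpleModule (SkewPolynomial D) M] (hX : X ∉ Module.annihilator (SkewPolynomial D) M)
    (hM : Module.annihilator (SkewPolynomial D) M ≠ ⊥) :
    ∃ g ∈ Subring.center (SkewPolynomial D),
      Module.annihilator (SkewPolynomial D) M = Ideal.span {g} := by
  obtain ⟨g, hg⟩ := (IsPrincipalIdealRing.principal
    (Module.annihilator (SkewPolynomial D) M)).principal
  rw [Ideal.submodule_span_eq] at hg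
  have hg0 : g ≠ 0 := by
    rintro rfl
    exact hM (hg.trans Ideal.span_zero)
  have hc : coeff g 0 ≠ 0 := coeff_zero_ne_zero_of_annihilator_eq_span hφ hX hg0 hg
  rw [← Ideal.span_singleton_mul_left_unit (isUnit_C (inv_ne_zero hc)) g] at hg
  refine ⟨C (coeff g 0)⁻¹ * g, mem_center_of_rightInvariant
    (rightInvariant_of_annihilator_eq_span hg) ?_, hg⟩
  rw [coeff_C_mul, inv_mul_cancel₀ hc]

theorem IsInnerPower.annihilator_V_eq_span_centralEval {u : D} {n : ℕ} (hun : IsInnerPower u n)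
    (hmin : ∀ j, 0 < j → j < n → ¬ IsInnerIterate D j) (hm : 1 < natDegree f)
    (hf : Irreducible f) {q : (FieldF D)[X]} (hq : IsMinCentralLeftMultiple u n f q) :
    Module.annihilator (SkewPolynomial D) (V f) = Ideal.span {centralEval u n q} := by
  have := isSimpleModule_V hf
  have hh0 := hun.centralEval_ne_zero hq.monic.ne_zero
  obtain ⟨r, hr⟩ := hq.mem
  have hh : centralEval u n q ∈ Module.annihilator (SkewPolynomial D) (V f) :=
    mem_annihilator_of_mem_center (hun.centralEval_mem_center q) (hr ▸ mul_mem_span r f)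
  have hX : X ∉ Module.annihilator (SkewPolynomial D) (V f) := fun hX => hm.not_ge <|
    natDegree_X (D := D) ▸ natDegree_le_of_mem_span (mem_span_of_mem_annihilator hX) X_ne_zero
  obtain ⟨g, hgc, hg⟩ := exists_mem_center_annihilator_eq_span hun.surjective hX
    ((Submodule.ne_bot_iff _).2 ⟨_, hh, hh0⟩)
  obtain ⟨q', rfl⟩ := hun.exists_centralEval_eq_of_mem_center hmin hgc
  have hq' : q' ≠ 0 := by
    rintro rfl
    rw [hg, centralEval, map_zero, Set.singleton_zero, Ideal.span_zero] at hh
    exact hh0 hh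
  obtain ⟨r', hr'⟩ := Ideal.mem_span_singleton'.1
    (mem_span_of_mem_annihilator (hg ▸ Ideal.mem_span_singleton_self _))
  rw [span_eq_span_of_mem_of_natDegree_le (hg ▸ hh) hh0 (hq.minimal q' hq' ⟨r', hr'.symm⟩), hg]

end Annihilator

section RankMetric

variable {K B ι : Type*}

theorem colRank_le_card_of_forall_notMem [Ring B] [StrongRankCondition Bᵐᵒᵖ] {M : Matrix ι ι B}
    {T : Finset ι} (hM : ∀ j ∉ T, ∀ i, M i j = 0) : colRank M ≤ T.card := by
  have hspan : Submodule.span Bᵐᵒᵖ (Set.range fun j i => M i j) =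
      Submodule.span Bᵐᵒᵖ (Set.range fun (j : T) i => M i j) := by
    refine le_antisymm (Submodule.span_le.2 ?_) (Submodule.span_mono ?_)
    · rintro _ ⟨j, rfl⟩
      by_cases hj : j ∈ T
      · exact Submodule.subset_span ⟨⟨j, hj⟩, rfl⟩
      · have hcol : (fun i => M i j) = 0 := funext (hM j hj)
        change (fun i => M i j) ∈ Submodule.span Bᵐᵒᵖ (Set.range fun (j : T) i => M i j)
        exact hcol ▸ zero_mem _
    · rintro _ ⟨j, rfl⟩
      exact ⟨j, rfl⟩
  rw [colRank, hspan, ← Fintype.card_coe]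
  exact finrank_range_le_card _

variable [Field K] [Fintype ι] [DivisionRing B] [Module K B] [Module.Finite K B]
variable {W : Submodule K (Matrix ι ι B)}

/-- The Singleton-like bound: by dimension, some nonzero element of `W` has `r` zero columns. -/
theorem exists_colRank_le_of_lt_finrank {r : ℕ} (hr : r ≤ Fintype.card ι)
    (hW : Fintype.card ι * r * Module.finrank K B < Module.finrank K W) :
    ∃ M ∈ W, M ≠ 0 ∧ colRank M ≤ Fintype.card ι - r := by
  classical
  obtain ⟨T, -, rfl⟩ := Finset.exists_subset_card_eq (s := (Finset.univ : Finset ι)) hr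
  let columns : W →ₗ[K] (T → ι → B) :=
    { toFun := fun M j i => M.1 i j
      map_add' := fun _ _ => rfl
      map_smul' := fun _ _ => rfl }
  have hker : LinearMap.ker columns ≠ ⊥ := by
    refine LinearMap.ker_ne_bot_of_finrank_lt (lt_of_eq_of_lt ?_ hW)
    simp only [Module.finrank_pi_fintype, Finset.sum_const, Finset.card_univ, Fintype.card_coe,
      smul_eq_mul]
    ring
  obtain ⟨M, hM, hM0⟩ := Submodule.exists_mem_ne_zero_of_ne_bot hker
  refine ⟨M, M.2, fun h => hM0 (Subtype.ext h), ?_⟩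
  rw [← Finset.card_compl]
  refine colRank_le_card_of_forall_notMem fun j hj i => ?_
  exact congrFun (congrFun (LinearMap.mem_ker.1 hM) ⟨j, Finset.notMem_compl.1 hj⟩) i

theorem isGenMRDCode_of_forall_lt_colRank {l : ℕ} (hl : 0 < l) (hlk : l ≤ Fintype.card ι)
    (hW : Module.finrank K W = Fintype.card ι * l * Module.finrank K B)
    (hrank : ∀ M ∈ W, M ≠ 0 → Fintype.card ι - l < colRank M) :
    IsGenMRDCode K (W : Set (Matrix ι ι B)) (Fintype.card ι - l + 1) := by
  obtain ⟨M, hM, hM0, hle⟩ := exists_colRank_le_of_lt_finrank (W := W) (r := l - 1) (by omega) <| by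
    rw [hW]
    exact Nat.mul_lt_mul_of_pos_right (Nat.mul_lt_mul_of_pos_left (by omega) (by omega))
      Module.finrank_pos
  refine ⟨inferInstance, fun b => IsUnit.mk0 b, inferInstance, ⟨?_, ?_⟩, by omega, W, rfl, ?_⟩
  · refine ⟨M, hM, 0, zero_mem W, hM0, ?_⟩
    have := hrank M hM hM0
    rw [sub_zero]
    omega
  · rintro _ ⟨P, hP, Q, hQ, hPQ, rfl⟩
    exact hrank _ (sub_mem hP hQ) (sub_ne_zero.2 hPQ)
  · rw [hW, show Fintype.card ι - (Fintype.card ι - l + 1) + 1 = l by omega]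

end RankMetric

section RankMetricMap

variable {B E ι : Type*} [Ring B] [Ring E]

theorem colRank_map (e : B ≃+* E) (M : Matrix ι ι B) : colRank (M.map e) = colRank M := by
  let s : Bᵐᵒᵖ ≃+* Eᵐᵒᵖ := RingEquiv.op e
  have := RingHomInvPair.of_ringEquiv s
  have := RingHomInvPair.of_ringEquiv s.symm
  let J : (ι → B) →ₛₗ[(s : Bᵐᵒᵖ →+* Eᵐᵒᵖ)] (ι → E) :=
    { toFun := fun x i => e (x i)
      map_add' := fun x y => funext fun i => map_add e _ _
      map_smul' := fun b x => funext fun i => map_mul e _ _ }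
  have hJ : Function.Injective J := e.injective.comp_left
  have hcols : (Set.range fun j i => (M.map e) i j) = J '' Set.range fun j i => M i j := by
    rw [← Set.range_comp]
    rfl
  rw [colRank, colRank, hcols, ← Submodule.map_span]
  let j := Submodule.equivMapOfInjective (σ₂₁ := (s.symm : Eᵐᵒᵖ →+* Bᵐᵒᵖ)) J hJ
    (Submodule.span Bᵐᵒᵖ (Set.range fun j i => M i j))
  have hrank := congrArg Cardinal.toNat <|
    lift_rank_eq_of_equiv_equiv s j.toAddEquiv s.bijective fun r m => j.map_smulₛₗ r m
  rw [Cardinal.toNat_lift, Cardinal.toNat_lift] at hrank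
  exact hrank.symm

theorem HasMinDist.map (e : B ≃+* E) {𝒞 : Set (Matrix ι ι B)} {δ : ℕ} (h : HasMinDist 𝒞 δ) :
    HasMinDist ((fun M => M.map e) '' 𝒞) δ := by
  have hsub (M N : Matrix ι ι B) : colRank (M.map e - N.map e) = colRank (M - N) := by
    rw [← Matrix.map_sub e (map_sub e), colRank_map]
  obtain ⟨⟨M, hM, N, hN, hne, hr⟩, hlow⟩ := h
  refine ⟨⟨_, ⟨M, hM, rfl⟩, _, ⟨N, hN, rfl⟩, (Matrix.map_injective e.injective).ne hne, ?_⟩, ?_⟩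
  · rw [hsub, hr]
  · rintro _ ⟨_, ⟨P, hP, rfl⟩, _, ⟨Q, hQ, rfl⟩, hPQ, rfl⟩
    exact hlow ⟨P, hP, Q, hQ, fun hPQ' => hPQ (by rw [hPQ']), hsub P Q⟩

theorem IsGenMRDCode.map {K : Type*} [Field K] [Algebra K B] [Algebra K E] [Fintype ι]
    (e : B ≃ₐ[K] E) {𝒞 : Set (Matrix ι ι B)} {δ : ℕ} (h : IsGenMRDCode K 𝒞 δ) :
    IsGenMRDCode K ((fun M => M.map e) '' 𝒞) δ := by
  have := h.nontrivial
  have := h.finite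
  obtain ⟨W, rfl, hdim⟩ := h.linear
  refine ⟨e.injective.nontrivial, fun b hb => ?_, Module.Finite.equiv e.toLinearEquiv,
    h.minDist.map e.toRingEquiv, h.dist_le,
    W.map (e.toLinearEquiv.mapMatrix : Matrix ι ι B ≃ₗ[K] Matrix ι ι E).toLinearMap, rfl, ?_⟩
  · have hb' : e.symm b ≠ 0 := (map_ne_zero_iff e.symm e.symm.injective).2 hb
    have hunit := (h.isUnit_of_ne_zero _ hb').map e
    rwa [AlgEquiv.apply_symm_apply] at hunit
  · rw [LinearEquiv.finrank_map_eq, hdim, e.toLinearEquiv.finrank_eq]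

end RankMetricMap

section Counting

variable {D : Type*} [DivisionRing D] [MulSemiringAction (Multiplicative ℕ) D]
variable {f : SkewPolynomial D} [Fact (1 < natDegree f)] [Fact (Irreducible f)]

theorem nonempty_equiv_pi {ι : Type*} [Finite ι] {w : ι → V f}
    (hw : LinearIndependent (NucB f)ᵐᵒᵖ w) {g : SkewPolynomial D}
    (hg : LinearMap.ker (evalMap w) = Ideal.span {g}) :
    Nonempty (V g ≃ₗ[SkewPolynomial D] (ι → V f)) :=
  nonempty_quotient_equiv_pi (E := (NucB f)ᵐᵒᵖ) toModuleEnd_op_surjective hw hg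

theorem nonempty_equiv_pi_of_basis {ι : Type*} [Finite ι]
    (v : Module.Basis ι (NucB f)ᵐᵒᵖ (V f)) {h : SkewPolynomial D}
    (hh : Module.annihilator (SkewPolynomial D) (V f) = Ideal.span {h}) :
    Nonempty (V h ≃ₗ[SkewPolynomial D] (ι → V f)) :=
  nonempty_equiv_pi v.linearIndependent ((ker_evalMap_of_span_eq_top v.span_eq).trans hh)

theorem natDegree_eq_card_mul_of_basis {ι : Type*} [Fintype ι]
    (v : Module.Basis ι (NucB f)ᵐᵒᵖ (V f)) {h : SkewPolynomial D} (hh0 : h ≠ 0)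
    (hh : Module.annihilator (SkewPolynomial D) (V f) = Ideal.span {h}) :
    natDegree h = Fintype.card ι * natDegree f := by
  obtain ⟨e⟩ := nonempty_equiv_pi_of_basis v hh
  exact natDegree_eq_of_equiv_pi (Fact.out : Irreducible f).ne_zero hh0 e

theorem card_eq_of_hasNumFactors {ι : Type*} [Fintype ι] (v : Module.Basis ι (NucB f)ᵐᵒᵖ (V f))
    {h : SkewPolynomial D} (hh : Module.annihilator (SkewPolynomial D) (V f) = Ideal.span {h})
    {k : ℕ} (hk : HasNumFactors h k) : Fintype.card ι = k := by
  obtain ⟨e⟩ := nonempty_equiv_pi_of_basis v hh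
  have hlength := e.length_eq
  rw [length_V_of_hasNumFactors hk, Module.length_pi, Module.length_eq_one, mul_one,
    ENat.card_eq_coe_fintype_card] at hlength
  exact_mod_cast hlength.symm

variable (K : Type*) [Field K] [Algebra K D] [SMulCommClass (Multiplicative ℕ) K D]

instance [Module.Finite K D] : Module.Finite K (V f) :=
  have := finite_V (Fact.out : Irreducible f).ne_zero
  Module.Finite.trans D (V f)

theorem finite_NucB [Module.Finite K D] : Module.Finite K (NucB f) :=
  have : Module.Finite K (reduced f) :=
    Module.Finite.equiv ((reducedEquivV f).restrictScalars K).symm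
  Module.Finite.of_injective
    (⟨⟨fun b => b.1, fun _ _ => rfl⟩, fun _ _ => rfl⟩ : NucB f →ₗ[K] reduced f)
    Subtype.val_injective

theorem finite_op_V [Module.Finite K D] : Module.Finite (NucB f)ᵐᵒᵖ (V f) :=
  Module.Finite.of_restrictScalars_finite K _ _

theorem nonempty_basis [Module.Finite K D] {h : SkewPolynomial D}
    (hh : Module.annihilator (SkewPolynomial D) (V f) = Ideal.span {h}) {k : ℕ}
    (hk : HasNumFactors h k) : Nonempty (Module.Basis (Fin k) (NucB f)ᵐᵒᵖ (V f)) := by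
  have := finite_op_V (f := f) K
  let b := Module.finBasis (NucB f)ᵐᵒᵖ (V f)
  have hcard := card_eq_of_hasNumFactors b hh hk
  rw [Fintype.card_fin] at hcard
  exact ⟨b.reindex (finCongr hcard)⟩

theorem card_mul_finrank_NucB {ι : Type*} [Fintype ι] (v : Module.Basis ι (NucB f)ᵐᵒᵖ (V f)) :
    Fintype.card ι * Module.finrank K (NucB f) = natDegree f * Module.finrank K D := by
  have hV := (Module.finrank_mul_finrank K D (V f)).trans
    (Module.finrank_mul_finrank K (NucB f)ᵐᵒᵖ (V f)).symm
  rw [finrank_V (Fact.out : Irreducible f).ne_zero, Module.finrank_eq_card_basis v,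
    ← (opLinearEquiv K (M := NucB f)).finrank_eq] at hV
  rw [mul_comm, ← hV, mul_comm]

end Counting

section LeftMul

variable {D : Type*} [DivisionRing D] [MulSemiringAction (Multiplicative ℕ) D]
variable {f : SkewPolynomial D} [Fact (1 < natDegree f)]

variable (f) in
/-- The left multiplication `x ↦ a x` of `V_f`, which commutes with the right action of
`Nuc_r(S_f)`. -/
def leftMul (a : SkewPolynomial D) : V f →ₗ[(NucB f)ᵐᵒᵖ] V f :=
  Module.toModuleEnd (NucB f)ᵐᵒᵖ (V f) a

section Kernel

variable [Fact (Irreducible f)]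

theorem nonempty_equiv_pi_of_forall_smul_eq_zero {ι : Type*} [Fintype ι] {w : ι → V f}
    (hw : LinearIndependent (NucB f)ᵐᵒᵖ w) {a : SkewPolynomial D} (ha : a ≠ 0)
    (hdeg : natDegree a ≤ Fintype.card ι * natDegree f) (haw : ∀ i, a • w i = 0) :
    Nonempty (V a ≃ₗ[SkewPolynomial D] (ι → V f)) := by
  obtain ⟨g, hg⟩ :=
    (IsPrincipalIdealRing.principal (LinearMap.ker (evalMap (R := SkewPolynomial D) w))).principal
  have hag : a ∈ Ideal.span {g} := hg.le (mem_ker_evalMap.2 haw)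
  have hg0 : g ≠ 0 := by
    rintro rfl
    exact ha (by simpa using hag)
  obtain ⟨e⟩ := nonempty_equiv_pi hw hg
  rw [← natDegree_eq_of_equiv_pi (Fact.out : Irreducible f).ne_zero hg0 e] at hdeg
  exact nonempty_equiv_pi hw (hg.trans (span_eq_span_of_mem_of_natDegree_le hag ha hdeg).symm)

theorem finrank_ker_leftMul_lt {a : SkewPolynomial D} (ha : a ≠ 0) {l : ℕ}
    (hdeg : natDegree a ≤ l * natDegree f)
    (hsim : natDegree a = l * natDegree f → ¬ AllIrreducibleFactorsSimilar a f) :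
    Module.finrank (NucB f)ᵐᵒᵖ (LinearMap.ker (leftMul f a)) < l := by
  by_contra! hl
  have hf : Irreducible f := Fact.out
  obtain ⟨w, hw⟩ := exists_linearIndependent_of_le_finrank hl
  obtain ⟨e⟩ := nonempty_equiv_pi_of_forall_smul_eq_zero (hw.map' _ (Submodule.ker_subtype _)) ha
    (by rwa [Fintype.card_fin]) fun i => (w i).2
  have hdeg_eq := natDegree_eq_of_equiv_pi hf.ne_zero ha e
  rw [Fintype.card_fin] at hdeg_eq
  exact hsim hdeg_eq (allIrreducibleFactorsSimilar_of_equiv hf ha e)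

end Kernel

variable {ι : Type*} [Finite ι] (v : Module.Basis ι (NucB f)ᵐᵒᵖ (V f))

/-- The coordinates with respect to a right basis of `V_f`, with values in `Nuc_r(S_f)` rather than
in its opposite. -/
def coordEquiv : V f ≃ₗ[(NucB f)ᵐᵒᵖ] (ι → NucB f) where
  toFun x i := unop (v.repr x i)
  map_add' x y := by
    ext i
    rw [map_add]
    rfl
  map_smul' b x := by
    ext i
    rw [map_smul]
    rfl
  invFun y := v.equivFun.symm fun i => op (y i)
  left_inv x := v.equivFun.symm_apply_apply x
  right_inv y := funext fun i =>
    congrArg unop (congrFun (v.equivFun.apply_symm_apply fun i => op (y i)) i)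

theorem colRank_leftMulMatrix (a : SkewPolynomial D) : colRank (leftMulMatrix v a) =
    Module.finrank (NucB f)ᵐᵒᵖ (LinearMap.range (leftMul f a)) := by
  have hcols : (Set.range fun j i => leftMulMatrix v a i j) =
      coordEquiv v '' (leftMul f a '' Set.range v) := by
    rw [← Set.range_comp, ← Set.range_comp]
    rfl
  rw [colRank, hcols, ← LinearEquiv.coe_coe, Submodule.span_image, Submodule.span_image, v.span_eq,
    Submodule.map_top]
  exact LinearEquiv.finrank_map_eq (coordEquiv v) _

theorem leftMulMatrix_eq_zero_iff {a : SkewPolynomial D} :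
    leftMulMatrix v a = 0 ↔ a ∈ Module.annihilator (SkewPolynomial D) (V f) := by
  rw [← ker_evalMap_of_span_eq_top v.span_eq, mem_ker_evalMap]
  constructor
  · intro h j
    exact (coordEquiv v).map_eq_zero_iff.1 (funext fun i => congrFun (congrFun h i) j)
  · intro h
    ext1 i j
    change coordEquiv v (a • v j) i = 0
    rw [h, map_zero, Pi.zero_apply]

/-- The map `a ↦ M_a`, linear over a central subfield `K` of `D` fixed by `σ`. -/
def leftMulMatrixLinear (K : Type*) [Field K] [Algebra K D]
    [SMulCommClass (Multiplicative ℕ) K D] : SkewPolynomial D →ₗ[K] Matrix ι ι (NucB f) where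
  toFun := leftMulMatrix v
  map_add' a b := by
    ext1 i j
    change unop (v.repr ((a + b) • v j) i) = _
    rw [add_smul, map_add]
    rfl
  map_smul' c a := by
    ext1 i j
    change unop (v.repr ((c • a) • v j) i) = _
    rw [smul_assoc, ← algebraMap_smul (NucB f)ᵐᵒᵖ c (a • v j), map_smul, algebraMap_smul]
    rfl

end LeftMul

section SetA

variable {D : Type*} [DivisionRing D] (K : Type*) [Field K] [Algebra K D] (ν : D) (ρ : D ≃+* D)
  (hρ : ∀ c : K, ρ (algebraMap K D c) = algebraMap K D c) (N : ℕ) [NeZero N]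

/-- The parametrization of the set `A` by the coefficients `d₀, …, d_{N-1}`. -/
def setALinear : (Fin N → D) →ₗ[K] SkewPolynomial D where
  toFun d := (∑ i : Fin N, monomial i (d i)) + monomial N (ν * ρ (d 0))
  map_add' d e := by
    simp only [Pi.add_apply, map_add, mul_add, Finset.sum_add_distrib]
    abel
  map_smul' c d := by
    have hρc : ν * ρ (c • d 0) = c • (ν * ρ (d 0)) := by
      rw [Algebra.smul_def, map_mul, hρ, ← Algebra.smul_def, mul_smul_comm]
    simp only [Pi.smul_apply, hρc, RingHom.id_apply, smul_add, Finset.smul_sum, smul_monomial]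

theorem setALinear_apply (d : Fin N → D) : setALinear K ν ρ hρ N d =
    (∑ i : Fin N, monomial i.1 (d i)) + monomial N (ν * ρ (d 0)) := rfl

theorem coeff_setALinear (d : Fin N → D) (i : Fin N) :
    coeff (setALinear K ν ρ hρ N d) i = d i := by
  rw [setALinear_apply, coeff_add, coeff_sum_monomial, dif_pos i.2, coeff_monomial,
    if_neg i.2.ne', add_zero]

theorem setALinear_injective : Function.Injective (setALinear K ν ρ hρ N) := fun d e h => by
  ext i
  rw [← coeff_setALinear K ν ρ hρ N d, h, coeff_setALinear]

theorem natDegree_setALinear_le (d : Fin N → D) : natDegree (setALinear K ν ρ hρ N d) ≤ N := by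
  refine natDegree_le fun j hj => ?_
  rw [setALinear_apply, coeff_add, coeff_sum_monomial, dif_neg hj.not_gt, coeff_monomial,
    if_neg hj.ne, add_zero]

theorem range_setALinear [MulSemiringAction (Multiplicative ℕ) D] :
    Set.range (setALinear K ν ρ hρ N) = setA ν ρ N := by
  ext a
  constructor
  · rintro ⟨d, rfl⟩
    refine ⟨fun i => if h : i < N then d ⟨i, h⟩ else 0, ?_⟩
    rw [setALinear_apply, Finset.sum_range]
    simp only [C_mul_X_pow_eq_monomial, Fin.is_lt, dif_pos, Fin.eta, NeZero.pos]
    rfl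
  · rintro ⟨d, rfl⟩
    refine ⟨fun i => d i, ?_⟩
    rw [setALinear_apply, Finset.sum_range]
    simp only [C_mul_X_pow_eq_monomial, Fin.val_zero]

theorem code_eq_image [MulSemiringAction (Multiplicative ℕ) D] {f : SkewPolynomial D} {ι : Type*}
    (v : Module.Basis ι (NucB f)ᵐᵒᵖ (V f)) {h : SkewPolynomial D}
    (hh : Module.annihilator (SkewPolynomial D) (V f) = Ideal.span {h}) (ν : D) (ρ : D ≃+* D)
    (N : ℕ) : code v h (setS ν ρ N h) = leftMulMatrix v '' setA ν ρ N := by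
  ext M
  constructor
  · rintro ⟨a, ⟨a', ha', haa'⟩, rfl⟩
    rw [Submodule.Quotient.eq, ← hh, Module.mem_annihilator] at haa'
    refine ⟨a', ha', ?_⟩
    ext1 i j
    rw [leftMulMatrix, leftMulMatrix, sub_eq_zero.1 ((sub_smul _ _ _).symm.trans (haa' (v j)))]
  · rintro ⟨a, ha, rfl⟩
    exact ⟨a, ⟨a, ha, rfl⟩, rfl⟩

end SetA

section MRD

variable {D : Type*} [DivisionRing D] [MulSemiringAction (Multiplicative ℕ) D]
variable {f : SkewPolynomial D} [Fact (1 < natDegree f)] [Fact (Irreducible f)]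
variable {ι : Type*} [Fintype ι] (v : Module.Basis ι (NucB f)ᵐᵒᵖ (V f))

theorem colRank_leftMulMatrix_add_finrank_ker (a : SkewPolynomial D) :
    colRank (leftMulMatrix v a) + Module.finrank (NucB f)ᵐᵒᵖ (LinearMap.ker (leftMul f a)) =
      Fintype.card ι := by
  have := Module.Finite.of_basis v
  rw [colRank_leftMulMatrix, LinearMap.finrank_range_add_finrank_ker,
    Module.finrank_eq_card_basis v]

theorem leftMulMatrix_eq_zero_of_natDegree_lt {h : SkewPolynomial D}
    (hh : Module.annihilator (SkewPolynomial D) (V f) = Ideal.span {h}) (hh0 : h ≠ 0)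
    {a : SkewPolynomial D} (ha : natDegree a < Fintype.card ι * natDegree f)
    (hM : leftMulMatrix v a = 0) : a = 0 := by
  rw [leftMulMatrix_eq_zero_iff, hh] at hM
  rw [← natDegree_eq_card_mul_of_basis v hh0 hh] at ha
  by_contra ha0
  exact ha.not_ge (natDegree_le_of_mem_span hM ha0)

theorem isGenMRDCode_code (K : Type*) [Field K] [Algebra K D]
    [SMulCommClass (Multiplicative ℕ) K D] [Module.Finite K D] {h : SkewPolynomial D}
    (hh : Module.annihilator (SkewPolynomial D) (V f) = Ideal.span {h}) (hh0 : h ≠ 0)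
    (ν : D) (ρ : D ≃+* D) (hρ : ∀ c : K, ρ (algebraMap K D c) = algebraMap K D c)
    {l : ℕ} (hl : 0 < l) (hlk : l < Fintype.card ι)
    (hA : ¬ ∃ g ∈ setA ν ρ (l * natDegree f), natDegree g = l * natDegree f ∧
      AllIrreducibleFactorsSimilar g f) :
    IsGenMRDCode K (code v h (setS ν ρ (l * natDegree f) h)) (Fintype.card ι - l + 1) := by
  have hm : 0 < natDegree f := Nat.zero_lt_one.trans Fact.out
  have : NeZero (l * natDegree f) := ⟨(Nat.mul_pos hl hm).ne'⟩
  have := finite_NucB (f := f) K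
  let A := setALinear K ν ρ hρ (l * natDegree f)
  have hA_inj : Function.Injective A := setALinear_injective K ν ρ hρ _
  have hA_deg (d) : natDegree (A d) ≤ l * natDegree f := natDegree_setALinear_le K ν ρ hρ _ d
  let L := leftMulMatrixLinear v K ∘ₗ A
  have hL : Function.Injective L := (injective_iff_map_eq_zero L).2 fun d hd => by
    have hlt := (hA_deg d).trans_lt (Nat.mul_lt_mul_of_pos_right hlk hm)
    have hAd := leftMulMatrix_eq_zero_of_natDegree_lt v hh hh0 hlt hd
    exact (map_eq_zero_iff A hA_inj).1 hAd
  have hcode : code v h (setS ν ρ (l * natDegree f) h) = LinearMap.range L := by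
    rw [code_eq_image v hh, ← range_setALinear K ν ρ hρ, ← Set.range_comp]
    rfl
  rw [hcode]
  refine isGenMRDCode_of_forall_lt_colRank hl hlk.le ?_ ?_
  · rw [LinearMap.finrank_range_of_inj hL, Module.finrank_pi_fintype, Finset.sum_const,
      Finset.card_univ, Fintype.card_fin, smul_eq_mul, mul_assoc, ← card_mul_finrank_NucB K v]
    ring
  · rintro _ ⟨d, rfl⟩ hd
    have hAd : A d ≠ 0 := fun h0 => hd ((congrArg (leftMulMatrixLinear v K) h0).trans (map_zero _))
    have hmem : A d ∈ setA ν ρ (l * natDegree f) :=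
      range_setALinear K ν ρ hρ (l * natDegree f) ▸ ⟨d, rfl⟩
    have hker := finrank_ker_leftMul_lt hAd (hA_deg d) fun hdeg hsim => hA ⟨_, hmem, hdeg, hsim⟩
    have hrank := colRank_leftMulMatrix_add_finrank_ker v (A d)
    change _ < colRank (leftMulMatrix v (A d))
    omega

end MRD

section FixedField

theorem finite_zpowers_of_pow_eq_one {G : Type*} [Group G] {g : G} {n : ℕ} (hn : 0 < n)
    (hg : g ^ n = 1) : Finite (Subgroup.zpowers g) :=
  finite_zpowers.2 (isOfFinOrder_iff_pow_eq_one.2 ⟨n, hn, hg⟩)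

theorem finrank_fixedPoints_zpowers_le {L : Type*} [Field L] {τ : RingAut L} {n : ℕ} (hn : 0 < n)
    (hτ : τ ^ n = 1) :
    Module.finrank (FixedPoints.subfield (Subgroup.zpowers τ) L) L ≤ n := by
  have := finite_zpowers_of_pow_eq_one hn hτ
  let := Fintype.ofFinite (Subgroup.zpowers τ)
  calc Module.finrank (FixedPoints.subfield (Subgroup.zpowers τ) L) L
      ≤ Fintype.card (Subgroup.zpowers τ) := FixedPoints.finrank_le_card _ L
    _ = orderOf τ := by rw [← Nat.card_eq_fintype_card, Nat.card_zpowers]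
    _ ≤ n := orderOf_le_of_pow_eq_one hn hτ

theorem centerCongr_pow_apply {D : Type*} [DivisionRing D] (σ : D ≃+* D) (j : ℕ)
    (c : Subring.center D) :
    (((Subring.centerCongr σ : RingAut (Subring.center D)) ^ j) c).1 = σ^[j] c.1 := by
  induction j generalizing c with
  | zero => rfl
  | succ j ih =>
    rw [pow_succ, Function.iterate_succ_apply]
    exact ih _

theorem centerCongr_pow_eq_one {D : Type*} [DivisionRing D] {σ : D ≃+* D} {n : ℕ}
    (hfix : ∀ c ∈ Subring.center D, σ^[n] c = c) :
    (Subring.centerCongr σ : RingAut (Subring.center D)) ^ n = 1 :=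
  RingEquiv.ext fun c => Subtype.ext ((centerCongr_pow_apply σ n c).trans (hfix _ c.2))

variable {D : Type*} [DivisionRing D] [MulSemiringAction (Multiplicative ℕ) D]

instance : Algebra (FieldF D) (Subring.center D) :=
  (Subring.inclusion fun _ hc => hc.1 : fixedCenter D →+* Subring.center D).toAlgebra

instance : IsScalarTower (FieldF D) (Subring.center D) D := ⟨fun a b c => mul_assoc a.1 b.1 c⟩

/-- `F` is the fixed field of the automorphism of the center of `D` induced by `σ`. -/
def fieldFEquivFixedPoints (σ : D ≃+* D) (hσ : ⇑σ = φ) :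
    FieldF D ≃+* FixedPoints.subfield
      (Subgroup.zpowers (Subring.centerCongr σ : RingAut (Subring.center D)))
      (Subring.center D) where
  toFun c := ⟨⟨c.1, c.2.1⟩, fun g => by
    have hc : (Subring.centerCongr σ : RingAut (Subring.center D)) ∈
        MulAction.stabilizer (RingAut (Subring.center D)) (⟨c.1, c.2.1⟩ : Subring.center D) :=
      Subtype.ext ((congrFun hσ _).trans c.2.2)
    exact Subgroup.zpowers_le.2 hc g.2⟩
  invFun c := ⟨c.1.1, c.1.2, (congrFun hσ _).symm.trans
    (congrArg Subtype.val (c.2 ⟨_, Subgroup.mem_zpowers _⟩))⟩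
  left_inv _ := rfl
  right_inv _ := rfl
  map_mul' _ _ := rfl
  map_add' _ _ := rfl

variable {σ : D ≃+* D} {n : ℕ}

theorem finite_fieldF_center (hσ : ⇑σ = φ) (hn : 0 < n)
    (hfix : ∀ c ∈ Subring.center D, σ^[n] c = c) :
    Module.Finite (FieldF D) (Subring.center D) := by
  have := finite_zpowers_of_pow_eq_one hn (centerCongr_pow_eq_one hfix)
  exact Module.Finite.of_equiv_equiv (fieldFEquivFixedPoints σ hσ).symm
    (RingEquiv.refl (Subring.center D)) rfl

theorem finrank_fieldF_center_le (hσ : ⇑σ = φ) (hn : 0 < n)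
    (hfix : ∀ c ∈ Subring.center D, σ^[n] c = c) :
    Module.finrank (FieldF D) (Subring.center D) ≤ n := by
  rw [Algebra.finrank_eq_of_equiv_equiv (fieldFEquivFixedPoints σ hσ)
    (RingEquiv.refl (Subring.center D)) rfl]
  exact finrank_fixedPoints_zpowers_le hn (centerCongr_pow_eq_one hfix)

variable {u : D} (hun : IsInnerPower u n)
include hun

theorem IsInnerPower.iterate_apply_of_mem_center (hσ : ⇑σ = φ) :
    ∀ c ∈ Subring.center D, σ^[n] c = c := fun c hc => by
  rw [hσ, hun.iterate_apply, Subring.mem_center_iff.1 hc u, mul_inv_cancel_right₀ hun.ne_zero]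

theorem IsInnerPower.finite_fieldF [Module.Finite (Subring.center D) D] (hσ : ⇑σ = φ) :
    Module.Finite (FieldF D) D := by
  have := finite_fieldF_center hσ hun.pos (hun.iterate_apply_of_mem_center hσ)
  exact Module.Finite.trans (Subring.center D) D

theorem IsInnerPower.finrank_fieldF_le (hσ : ⇑σ = φ) :
    Module.finrank (FieldF D) D ≤ n * Module.finrank (Subring.center D) D := by
  rw [← Module.finrank_mul_finrank (FieldF D) (Subring.center D) D]
  exact Nat.mul_le_mul_right _
    (finrank_fieldF_center_le hσ hun.pos (hun.iterate_apply_of_mem_center hσ))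

end FixedField

section CentralNucleus

theorem exists_adjoinRoot_algEquiv {K B : Type*} [Field K] [Ring B] [Algebra K B]
    [Module.Finite K B] {b : B} {h : K[X]} (hb : ∀ q, Polynomial.aeval b q = 0 ↔ h ∣ q)
    (hdim : Module.finrank K B ≤ h.natDegree) :
    ∃ e : AdjoinRoot h ≃ₐ[K] B, e (AdjoinRoot.root h) = b := by
  let T : AdjoinRoot h →ₐ[K] B := Ideal.Quotient.liftₐ (Ideal.span {h}) (Polynomial.aeval b)
    fun q hq => (hb q).2 (Ideal.mem_span_singleton.1 hq)
  have hT : Function.Injective T := (injective_iff_map_eq_zero T).2 fun x hx => by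
    obtain ⟨q, rfl⟩ := AdjoinRoot.mk_surjective x
    exact AdjoinRoot.mk_eq_zero.2 ((hb q).1 hx)
  have hfinite : Module.Finite K (AdjoinRoot h) := Module.Finite.of_injective T.toLinearMap hT
  have hfinrank : Module.finrank K (AdjoinRoot h) = Module.finrank K B :=
    (LinearMap.finrank_le_finrank_of_injective (f := T.toLinearMap) hT).antisymm
      (hdim.trans_eq finrank_quotient_span_eq_natDegree.symm)
  have hsurj := (LinearMap.injective_iff_surjective_of_finrank_eq_finrank
    (f := T.toLinearMap) hfinrank).1 hT
  exact ⟨AlgEquiv.ofBijective T ⟨hT, hsurj⟩, Polynomial.aeval_X b⟩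

variable {D : Type*} [DivisionRing D] [MulSemiringAction (Multiplicative ℕ) D]
variable {f : SkewPolynomial D}

theorem PetitAlgebra.mk_mul_mk {p q : SkewPolynomial D} (hq : f * q ∈ Ideal.span {f}) :
    PetitAlgebra.mk f p * PetitAlgebra.mk f q = PetitAlgebra.mk f (p * q) := by
  rw [PetitAlgebra.mul_def', mk_eq_mk_iff, PetitAlgebra.val_mk, PetitAlgebra.val_mk]
  have hleft := mul_mem_span_of_mem hq (sub_modR_mem f p)
  have hright := Ideal.mul_mem_left _ (modR f p) (sub_modR_mem f q)
  have hsum := neg_mem (add_mem hright hleft)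
  rwa [mul_sub, sub_mul, add_comm, sub_add_sub_cancel, neg_sub] at hsum

namespace IsInnerPower

variable {u : D} {n : ℕ} (hun : IsInnerPower u n)
include hun

theorem mul_C_inv_mul_X_pow_mem_span (f : SkewPolynomial D) :
    f * (C u⁻¹ * X ^ n) ∈ Ideal.span {f} := by
  rw [Subring.mem_center_iff.1 hun.C_inv_mul_X_pow_mem_center f]
  exact mul_mem_span _ f

variable (f) in
/-- The class of the central element `u⁻¹ tⁿ` in `B`. -/
def nucGenerator : NucB f :=
  ⟨PetitAlgebra.mk f (C u⁻¹ * X ^ n), mk_mem_rightNucleus (hun.mul_C_inv_mul_X_pow_mem_span f)⟩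

theorem dvd_of_centralEval_mem_span {h q : (FieldF D)[X]} (hh : IsMinCentralLeftMultiple u n f h)
    (hq : centralEval u n q ∈ Ideal.span {f}) : h ∣ q := by
  rw [← Polynomial.modByMonic_eq_zero_iff_dvd hh.monic]
  by_contra hne
  obtain ⟨g, hg⟩ := hh.mem
  have hmem : centralEval u n (q %ₘ h) ∈ Ideal.span {f} := by
    rw [Polynomial.modByMonic_eq_sub_mul_div, centralEval, map_sub, mul_comm, map_mul]
    exact sub_mem hq (Ideal.mul_mem_left _ _ (Ideal.mem_span_singleton'.2 ⟨g, hg.symm⟩))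
  obtain ⟨r, hr⟩ := Ideal.mem_span_singleton'.1 hmem
  have hle := hh.minimal _ hne ⟨r, hr.symm⟩
  rw [hun.natDegree_centralEval, hun.natDegree_centralEval] at hle
  exact (Polynomial.natDegree_lt_natDegree hne (Polynomial.degree_modByMonic_lt q hh.monic)).not_ge
    (Nat.le_of_mul_le_mul_left hle hun.pos)

theorem centralEval_mem_span_iff_dvd {h q : (FieldF D)[X]}
    (hh : IsMinCentralLeftMultiple u n f h) : centralEval u n q ∈ Ideal.span {f} ↔ h ∣ q := by
  refine ⟨hun.dvd_of_centralEval_mem_span hh, ?_⟩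
  rintro ⟨p, rfl⟩
  obtain ⟨g, hg⟩ := hh.mem
  rw [mul_comm, centralEval, map_mul]
  exact Ideal.mul_mem_left _ _ (Ideal.mem_span_singleton'.2 ⟨g, hg.symm⟩)

theorem aeval_nucGenerator (q : (FieldF D)[X]) :
    (Polynomial.aeval (hun.nucGenerator f) q : NucB f).1 =
      PetitAlgebra.mk f (centralEval u n q) := by
  induction q using Polynomial.induction_on with
  | C a =>
    rw [centralEval, Polynomial.aeval_C, Polynomial.aeval_C, Algebra.algebraMap_eq_smul_one,
      Algebra.algebraMap_eq_smul_one, PetitAlgebra.mk_smul]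
    rfl
  | add p q hp hq =>
    rw [centralEval, map_add, map_add, PetitAlgebra.mk_add, ← centralEval, ← centralEval, ← hp,
      ← hq]
    rfl
  | monomial j a ih =>
    rw [pow_succ, ← mul_assoc, centralEval, map_mul _ _ Polynomial.X, map_mul _ _ Polynomial.X,
      Polynomial.aeval_X, Polynomial.aeval_X, ← centralEval,
      ← PetitAlgebra.mk_mul_mk (hun.mul_C_inv_mul_X_pow_mem_span f), ← ih]
    rfl

theorem aeval_nucGenerator_eq_zero_iff {h q : (FieldF D)[X]}
    (hh : IsMinCentralLeftMultiple u n f h) :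
    Polynomial.aeval (hun.nucGenerator f) q = 0 ↔ h ∣ q := by
  have hmk := PetitAlgebra.mk_eq_mk_iff (f := f) (g := centralEval u n q) (g' := 0)
  rw [sub_zero, PetitAlgebra.mk_zero] at hmk
  rw [← hun.centralEval_mem_span_iff_dvd hh, ← hmk, ← hun.aeval_nucGenerator]
  exact Subtype.ext_iff

theorem finrank_NucB_le_natDegree [Fact (1 < natDegree f)] [Fact (Irreducible f)]
    {σ : D ≃+* D} (hσ : ⇑σ = φ) {d : ℕ} (hd : Module.finrank (Subring.center D) D = d ^ 2)
    {ι : Type*} [Fintype ι] (v : Module.Basis ι (NucB f)ᵐᵒᵖ (V f)) (hι : Fintype.card ι = d * n)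
    {q : (FieldF D)[X]} (hq : natDegree (centralEval u n q) = Fintype.card ι * natDegree f) :
    Module.finrank (FieldF D) (NucB f) ≤ q.natDegree := by
  have hq' : q.natDegree = d * natDegree f := by
    refine Nat.eq_of_mul_eq_mul_left hun.pos ?_
    rw [← hun.natDegree_centralEval, hq, hι]
    ring
  have := IsSimpleModule.nontrivial (SkewPolynomial D) (V f)
  have := v.index_nonempty
  refine Nat.le_of_mul_le_mul_left ?_ (Fintype.card_pos (α := ι))
  calc Fintype.card ι * Module.finrank (FieldF D) (NucB f)
      = natDegree f * Module.finrank (FieldF D) D := card_mul_finrank_NucB (FieldF D) v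
    _ ≤ natDegree f * (n * d ^ 2) := Nat.mul_le_mul_left _ (hd ▸ hun.finrank_fieldF_le hσ)
    _ = Fintype.card ι * q.natDegree := by rw [hι, hq']; ring

theorem exists_adjoinRoot_algEquiv_NucB [Fact (1 < natDegree f)] [Fact (Irreducible f)]
    [Module.Finite (FieldF D) D] {σ : D ≃+* D} (hσ : ⇑σ = φ) {d : ℕ}
    (hd : Module.finrank (Subring.center D) D = d ^ 2) {ι : Type*} [Fintype ι]
    (v : Module.Basis ι (NucB f)ᵐᵒᵖ (V f)) (hι : Fintype.card ι = d * n) {q : (FieldF D)[X]}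
    (hq : IsMinCentralLeftMultiple u n f q)
    (hdeg : natDegree (centralEval u n q) = Fintype.card ι * natDegree f) :
    ∃ e : AdjoinRoot q ≃ₐ[FieldF D] NucB f, e (AdjoinRoot.root q) = hun.nucGenerator f :=
  have := finite_NucB (f := f) (FieldF D)
  exists_adjoinRoot_algEquiv (fun _ => hun.aeval_nucGenerator_eq_zero_iff hq)
    (hun.finrank_NucB_le_natDegree hσ hd v hι hdeg)

end IsInnerPower

instance (ρ : D ≃+* D) : IsScalarTower (FieldF' ρ) (FieldF D) (NucB f) where
  smul_assoc a b x := Subtype.ext (PetitAlgebra.ext' (smul_assoc a b (x : PetitAlgebra f).val))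

end CentralNucleus

end SkewMRD

end

open SkewMRD in
theorem mainTheorem1
    {D : Type*} [DivisionRing D] [MulSemiringAction (Multiplicative ℕ) D]
    -- `D` is a division algebra of degree `d` over its center
    (d : ℕ) (hDfin : Module.Finite (Subring.center D) D)
    (hd : Module.finrank (Subring.center D) D = d ^ 2)
    -- `σ` is an automorphism of `D`, of order `n` modulo inner automorphisms
    (σ : D ≃+* D) (hσ : ∀ a, σ a = SkewPolynomial.φ a)
    (n : ℕ) (hn : 0 < n) (u : D) (hu : u ≠ 0) (hun : ∀ z, σ^[n] z = u * z * u⁻¹)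
    (hn_min : ∀ j, 0 < j → j < n → ¬ ∃ w : D, w ≠ 0 ∧ ∀ z, σ^[j] z = w * z * w⁻¹)
    (hσu : σ u = u)
    -- `f` is monic and irreducible of degree `m > 1`, not right-invariant, `(f, t)_r = 1`
    (f : SkewPolynomial D) (m : ℕ) (hm : 1 < m) (hfdeg : natDegree f = m) (hfmonic : f.coeff m = 1)
    (hf : Irreducible f) (hft : RightCoprime f SkewPolynomial.X) (hfinv : ¬ RightInvariant f)
    -- `h` is the minimal central left multiple of `f`, with `k` irreducible factors
    (hhat : (FieldF D)[X]) (hhhat : IsMinCentralLeftMultiple u n f hhat)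
    (h : SkewPolynomial D) (hh : h = centralEval u n hhat)
    (k : ℕ) (hk : HasNumFactors h k)
    (ρ : D ≃+* D) (hρ : Module.Finite (FieldF' ρ) (FieldF D)) (ν : D)
    (l : ℕ) (hl : 0 < l) (hlk : l < k)
    (hA : ¬ ∃ g ∈ setA ν ρ (l * m), natDegree g = l * m ∧ AllIrreducibleFactorsSimilar g f) :
    Nonempty (Module.Basis (Fin k) (NucB f)ᵐᵒᵖ (V f)) ∧
    (∀ v : Module.Basis (Fin k) (NucB f)ᵐᵒᵖ (V f),
      IsGenMRDCode (FieldF' ρ) (code v h (setS ν ρ (l * m) h)) (k - l + 1)) ∧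
    (natDegree h = d * m * n →
      k = d * n ∧
      ∃ e : AdjoinRoot hhat ≃ₐ[FieldF D] NucB f,
        (e (AdjoinRoot.root hhat) : PetitAlgebra f) =
          PetitAlgebra.mk f (SkewPolynomial.C u⁻¹ * SkewPolynomial.X ^ n) ∧
        ∀ v : Module.Basis (Fin (d * n)) (NucB f)ᵐᵒᵖ (V f),
          IsGenMRDCode (FieldF' ρ)
            ((fun M => M.map e.symm) '' code v h (setS ν ρ (l * m) h)) (d * n - l + 1)) := by
  have hφ : ⇑σ = SkewPolynomial.φ := funext hσ
  rw [hφ] at hun hn_min hσu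
  subst hfdeg
  have hσn : IsInnerPower u n := ⟨hn, hu, hun, hσu⟩
  have : Fact (1 < natDegree f) := ⟨hm⟩
  have : Fact (Irreducible f) := ⟨hf⟩
  have := hσn.finite_fieldF hφ
  have : Module.Finite (FieldF' ρ) D := Module.Finite.trans (FieldF D) D
  have hann : Module.annihilator _ (V f) = Ideal.span {h} :=
    hh ▸ hσn.annihilator_V_eq_span_centralEval hn_min hm hf hhhat
  have hh0 : h ≠ 0 := hh ▸ hσn.centralEval_ne_zero hhhat.monic.ne_zero
  have hMRD (v : Module.Basis (Fin k) (NucB f)ᵐᵒᵖ (V f)) :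
      IsGenMRDCode (FieldF' ρ) (code v h (setS ν ρ (l * natDegree f) h)) (k - l + 1) := by
    simpa only [Fintype.card_fin] using isGenMRDCode_code v (FieldF' ρ) hann hh0 ν ρ
      (fun c => c.2.2) hl (hlk.trans_eq (Fintype.card_fin k).symm) hA
  obtain ⟨b⟩ := nonempty_basis (FieldF D) hann hk
  refine ⟨⟨b⟩, hMRD, fun hdeg => ?_⟩
  have hdeg_b := natDegree_eq_card_mul_of_basis b hh0 hann
  obtain rfl : k = d * n := by
    rw [Fintype.card_fin, hdeg, mul_right_comm] at hdeg_b
    exact (Nat.eq_of_mul_eq_mul_right (Nat.zero_lt_of_lt hm) hdeg_b).symm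
  obtain ⟨e, he⟩ := hσn.exists_adjoinRoot_algEquiv_NucB hφ hd b (Fintype.card_fin _) hhhat
    (hh ▸ hdeg_b)
  exact ⟨rfl, e, congrArg Subtype.val he, fun v =>
    (hMRD v).map (e.symm.restrictScalars (FieldF' ρ))⟩
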